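/- Let $Q\in L^1_{\mathrm{loc}}(]0,\infty[;\mathbb{C})$ satisfy $\int_1^\infty|Q(x)|\,\mathrm{d}x<\infty$, and let $k\in\mathbb{C}$ with $\operatorname{Re}k\ge 0$, $k\neq 0$. For $m\in\mathbb{C}$ set $$L_{m^2}:=-\partial_x^2+\Big(m^2-\frac14\Big)\frac1{x^2}+Q(x),\qquad L^0_{m^2}:=-\partial_x^2+\Big(m^2-\frac14\Big)\frac1{x^2},\qquad w_m^0(x,k):=\sqrt{\tfrac{2kx}{\pi}}\,K_m(kx),$$ where $K_m$ is the Macdonald function, i.e. $\sqrt{\tfrac{2z}{\pi}}K_m(z)=\tfrac{\sqrt z}{\sqrt{2\pi}}\int_0^\infty \mathrm{e}^{-\frac z2(s+s^{-1})}s^{-m-1}\,\mathrm{d}s$ for $\operatorname{Re}z>0$, extended by continuity to the imaginary axis without $0$. Let $AC^1]0,\infty[$ be the set of differentiable functions $]0,\infty[\,\to\mathbb{C}$ whose derivative is locally absolutely continuous. Let $G^0_\leftarrow$ be the backward Green's operator of $L^0_{m^2}+k^2$, with integral kernel $$G^0_\leftarrow(x,y)=-\theta(y-x)\,\frac{h_1(x)h_2(y)-h_2(x)h_1(y)}{h_1h_2'-h_1'h_2},$$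 where $\theta$ is the Heaviside function and $h_1,h_2$ is any pair of solutions of $L^0_{m^2}h=-k^2h$ on $]0,\infty[$ with nonzero (constant) Wronskian $h_1h_2'-h_1'h_2$; the kernel does not depend on the choice of the pair. For $a>0$ let $X_a$ be the Banach space of (classes of) measurable functions $f$ on $]a,\infty[$ with $\operatorname{ess\,sup}_{x>a}|f(x)|\mathrm{e}^{x\operatorname{Re}k}<\infty$. Then for every $m\in\mathbb{C}$ there is a unique $w_m(\cdot,k)\in AC^1]0,\infty[$ that solves $L_{m^2}w=-k^2w$ (almost everywhere) on $]0,\infty[$ and satisfies $$w_m(x,k)-w_m^0(x,k)=o(\mathrm{e}^{-x\operatorname{Re}k}),\qquad \partial_xw_m(x,k)-\partial_xw_m^0(x,k)=o(\mathrm{e}^{-x\operatorname{Re}k}),\qquad x\to\infty.$$ It is given by $w_m(\cdot,k)=(1+G^0_\leftarrow Q)^{-1}w_m^0(\cdot,k)$, in the following sense: for every $a>0$ the operator $G^0_\leftarrow Q$ is bounded on $X_a$ (with absolutely convergent integrals), $1+G^0_\leftarrow Q$ is invertible on $X_a$ with bounded inverse, the restrictions of $w_m^0(\cdot,k)$ and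 $w_m(\cdot,k)$ to $]a,\infty[$ belong to $X_a$, and $w_m(x,k)+(G^0_\leftarrow Q\,w_m)(x,k)=w_m^0(x,k)$ for all $x>a$. Moreover $w_m(x,k)=w_{-m}(x,k)$ for all $m\in\mathbb{C}$ and $x>0$. -/

import Mathlib

open MeasureTheory Set Filter Asymptotics
open scoped ENNReal NNReal

noncomputable section

namespace PerturbedBessel

/-- The integral formula of the 1d Macdonald function; it converges for `Re z > 0`:
`√z / √(2π) * ∫₀^∞ exp (-(z/2) (s + s⁻¹)) s^(-m-1) ds = √(2z/π) K_m(z)`. -/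
def macdonaldIntegral (m z : ℂ) : ℂ :=
  z ^ (1 / 2 : ℂ) / (Real.sqrt (2 * Real.pi) : ℂ) *
    ∫ s in Ioi (0 : ℝ), Complex.exp (-(z / 2) * ((s : ℂ) + (s : ℂ)⁻¹)) * (s : ℂ) ^ (-m - 1)

/-- The 1d Macdonald function `𝒦_m(z) = √(2z/π) K_m(z)` for `Re z ≥ 0`, `z ≠ 0`: the integral
formula for `Re z > 0`, and its continuous extension (which is the restriction of the analytic
continuation to the plane cut along `]-∞, 0]`) on the imaginary axis. -/
def macdonald (m : ℂ) : ℂ → ℂ :=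
  extendFrom {z : ℂ | 0 < z.re} (macdonaldIntegral m)

/-- The unperturbed Jost solution `w_m^0(x, k) = 𝒦_m(k x)`. -/
def freeJost (m k : ℂ) (x : ℝ) : ℂ :=
  macdonald m (k * x)

/-- `f ∈ AC¹]0,∞[`: `f` is differentiable on `]0,∞[` and its derivative is absolutely continuous
on all compact subintervals of `]0,∞[`. Values at `x ≤ 0` are irrelevant. -/
def IsAC1 (f : ℝ → ℂ) : Prop :=
  DifferentiableOn ℝ f (Ioi 0) ∧
    ∀ a b : ℝ, 0 < a → a ≤ b → AbsolutelyContinuousOnInterval (deriv f) a b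

/-- The perturbed Bessel operator `L_{m²} = -∂ₓ² + (m² - 1/4) / x² + Q(x)`. -/
def besselOp (Q : ℝ → ℂ) (m : ℂ) (f : ℝ → ℂ) (x : ℝ) : ℂ :=
  -deriv (deriv f) x + ((m ^ 2 - 1 / 4) / (x : ℂ) ^ 2 + Q x) * f x

/-- `f ∈ AC¹]0,∞[` solves `L_{m²} f = -k² f` on `]0,∞[`. -/
def IsSolution (Q : ℝ → ℂ) (m k : ℂ) (f : ℝ → ℂ) : Prop :=
  IsAC1 f ∧ ∀ᵐ x ∂(volume.restrict (Ioi (0 : ℝ))), besselOp Q m f x = -k ^ 2 * f x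

def wronskian (f g : ℝ → ℂ) (x : ℝ) : ℂ :=
  f x * deriv g x - deriv f x * g x

/-- Two solutions of the unperturbed equation with nonzero Wronskian. The Wronskian of two
solutions is constant on `]0,∞[`, so that it may be evaluated at `x = 1`. -/
def IsFundamentalPair (m k : ℂ) (h : (ℝ → ℂ) × (ℝ → ℂ)) : Prop :=
  IsSolution 0 m k h.1 ∧ IsSolution 0 m k h.2 ∧ wronskian h.1 h.2 1 ≠ 0

/-- Some fundamental pair of the unperturbed equation (one always exists). -/
def fundamentalPair (m k : ℂ) : (ℝ → ℂ) × (ℝ → ℂ) :=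
  Classical.epsilon (IsFundamentalPair m k)

/-- The integral kernel of the canonical bisolution,
`(h₁(x) h₂(y) - h₂(x) h₁(y)) / 𝒲(h₁, h₂)`. For `x, y > 0` it does not depend on the choice of the
fundamental pair. -/
def canonicalBisolution (m k : ℂ) (x y : ℝ) : ℂ :=
  ((fundamentalPair m k).1 x * (fundamentalPair m k).2 y -
      (fundamentalPair m k).2 x * (fundamentalPair m k).1 y) /
    wronskian (fundamentalPair m k).1 (fundamentalPair m k).2 1

/-- The kernel of the backward Green's operator, `-θ(y - x) G_↔(x, y)`. -/
def backwardGreen (m k : ℂ) (x y : ℝ) : ℂ :=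
  if x ≤ y then -canonicalBisolution m k x y else 0

/-- The kernel of the composition of the backward Green's operator with the multiplication
by `Q`. -/
def backwardGreenMul (Q : ℝ → ℂ) (m k : ℂ) (x y : ℝ) : ℂ :=
  backwardGreen m k x y * Q y

/-- The operator with integral kernel `K`, acting on functions on `]a,∞[`. -/
def kernelOp (a : ℝ) (K : ℝ → ℝ → ℂ) (f : ℝ → ℂ) (x : ℝ) : ℂ :=
  ∫ y in Ioi a, K x y * f y

/-- The weight `x ↦ exp (-x Re k)`. -/
def expWeight (k : ℂ) (x : ℝ) : ℝ :=
  Real.exp (-x * k.re)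

/-- The norm of the weighted space `L^∞(]a,∞[, φ)`, the essential supremum of `|f / φ|`. -/
def weightedNorm (a : ℝ) (φ : ℝ → ℝ) (f : ℝ → ℂ) : ℝ≥0∞ :=
  eLpNorm (fun x => f x / (φ x : ℂ)) ∞ (volume.restrict (Ioi a))

/-- `f ∈ L^∞(]a,∞[, φ)`. -/
def MemWeighted (a : ℝ) (φ : ℝ → ℝ) (f : ℝ → ℂ) : Prop :=
  MemLp (fun x => f x / (φ x : ℂ)) ∞ (volume.restrict (Ioi a))

/-- `K` is the kernel of a bounded operator on `L^∞(]a,∞[, φ)` (with absolutely convergent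
integrals), and `1 + K` is invertible there, with bounded inverse. -/
structure OneAddInvertible (a : ℝ) (φ : ℝ → ℝ) (K : ℝ → ℝ → ℂ) : Prop where
  integrable : ∀ f, MemWeighted a φ f → ∀ x, a < x → IntegrableOn (fun y => K x y * f y) (Ioi a)
  bounded : ∃ C : ℝ≥0, ∀ f, MemWeighted a φ f →
    MemWeighted a φ (kernelOp a K f) ∧
      weightedNorm a φ (kernelOp a K f) ≤ C * weightedNorm a φ f
  injective : ∀ g₁ g₂, MemWeighted a φ g₁ → MemWeighted a φ g₂ →
    (∀ᵐ x ∂(volume.restrict (Ioi a)), g₁ x + kernelOp a K g₁ x = g₂ x + kernelOp a K g₂ x) →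
    g₁ =ᵐ[volume.restrict (Ioi a)] g₂
  surjective : ∃ C : ℝ≥0, ∀ f, MemWeighted a φ f → ∃ g, MemWeighted a φ g ∧
    weightedNorm a φ g ≤ C * weightedNorm a φ f ∧
    ∀ᵐ x ∂(volume.restrict (Ioi a)), g x + kernelOp a K g x = f x

/-- `g = (1 + K)⁻¹ f` on `]a,∞[`: both functions belong to `L^∞(]a,∞[, φ)`, the operator
`1 + K` is invertible on that space, and `(1 + K) g = f` on `]a,∞[`. -/
def IsInverseImage (a : ℝ) (φ : ℝ → ℝ) (K : ℝ → ℝ → ℂ) (f g : ℝ → ℂ) : Prop :=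
  OneAddInvertible a φ K ∧ MemWeighted a φ f ∧ MemWeighted a φ g ∧
    ∀ x, a < x → g x + kernelOp a K g x = f x

/-- `w ∈ AC¹]0,∞[` solves the perturbed equation and is asymptotic to the unperturbed Jost
solution at infinity, together with its derivative, up to `o(exp (-x Re k))`. -/
structure IsJostSolution (Q : ℝ → ℂ) (m k : ℂ) (w : ℝ → ℂ) : Prop where
  isSolution : IsSolution Q m k w
  sub_isLittleO : (fun x => w x - freeJost m k x) =o[atTop] expWeight k
  deriv_sub_isLittleO :
    (fun x => deriv w x - deriv (freeJost m k) x) =o[atTop] expWeight k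

end PerturbedBessel

end

/-!
Both conditions on `w` together amount to the integral equation `(1 + G Q) w = w⁰`, where `G` is the
backward Green's operator. By variation of constants, `f = -G g` solves `f'' = V f + g` with
`V = k² + (m² - 1/4) / x²`, and `f` and `f'` are `o(exp (-x Re k))`; no other solution decays like
this, because a solution of `f'' = V f` with that decay has vanishing Wronskians with all others.

The kernel of `G` is estimated through the energy `‖h'‖² + ‖k h‖²` of a solution of `h'' = V h`: its
logarithmic derivative is at most `2 Re k + ‖V - k²‖ / ‖k‖`, and `V - k²` is integrable at infinity.
So `G Q` is a Volterra operator with an integrable bound `q`, and passing to the equivalent weight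
`exp (-x Re k) exp (2 ∫ q)`, with `∫ q` over `]x,∞[`, makes its norm less than `1`.

On the imaginary axis the integral formula of `K_m` diverges. The substitution
`v = 2 √z sinh (t / 2)` turns it into a Gaussian integral, which is holomorphic on a sector that
contains the closed right half-plane without `0`; there the differential equation and the decay of
`w⁰` follow by analytic continuation.
-/

noncomputable section

open scoped Topology

namespace PerturbedBessel

/-! ### Locally absolutely continuous functions -/

section AbsolutelyContinuous

variable {E F : Type*} [NormedAddCommGroup E] [NormedSpace ℝ E] [SeminormedAddCommGroup F]

section Comparison

variable {X Y : Type*} [PseudoMetricSpace X] [PseudoMetricSpace Y] {f : ℝ → X} {g : ℝ → Y}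
  {a b : ℝ}

lemma absolutelyContinuousOnInterval_of_dist_le_mul (hf : AbsolutelyContinuousOnInterval f a b)
    (K : ℝ≥0)
    (h : ∀ x ∈ uIcc a b, ∀ y ∈ uIcc a b, dist (g x) (g y) ≤ K * dist (f x) (f y)) :
    AbsolutelyContinuousOnInterval g a b := by
  rw [absolutelyContinuousOnInterval_iff] at hf ⊢
  intro ε hε
  obtain ⟨δ, hδ, hfδ⟩ := hf (ε / (K + 1)) (by positivity)
  refine ⟨δ, hδ, fun I hI hlt => ?_⟩
  calc ∑ i ∈ Finset.range I.1, dist (g (I.2 i).1) (g (I.2 i).2)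
      ≤ ∑ i ∈ Finset.range I.1, (K + 1) * dist (f (I.2 i).1) (f (I.2 i).2) :=
        Finset.sum_le_sum fun i hi => (h _ (hI.1 i hi).1 _ (hI.1 i hi).2).trans
          (mul_le_mul_of_nonneg_right (lt_add_one _).le dist_nonneg)
    _ = (K + 1) * ∑ i ∈ Finset.range I.1, dist (f (I.2 i).1) (f (I.2 i).2) :=
        (Finset.mul_sum ..).symm
    _ < ε := (lt_div_iff₀' (by positivity)).1 (hfδ I hI hlt)

lemma absolutelyContinuousOnInterval_of_dist_le (hf : AbsolutelyContinuousOnInterval f a b)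
    (h : ∀ x ∈ uIcc a b, ∀ y ∈ uIcc a b, dist (g x) (g y) ≤ dist (f x) (f y)) :
    AbsolutelyContinuousOnInterval g a b :=
  absolutelyContinuousOnInterval_of_dist_le_mul hf 1 fun x hx y hy => by
    simpa only [NNReal.coe_one, one_mul] using h x hx y hy

end Comparison

lemma absolutelyContinuousOnInterval_integral {f : ℝ → E} {a b : ℝ}
    (hf : IntervalIntegrable f volume a b) :
    AbsolutelyContinuousOnInterval (fun x => ∫ t in a..x, f t) a b := by
  refine absolutelyContinuousOnInterval_of_dist_le
    (hf.norm.absolutelyContinuousOnInterval_intervalIntegral left_mem_uIcc) fun x hx y hy => ?_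
  have hfx : ∀ z ∈ uIcc a b, IntervalIntegrable f volume a z := fun z hz =>
    hf.mono_set (uIcc_subset_uIcc_left hz)
  rw [dist_eq_norm, dist_eq_norm, intervalIntegral.integral_interval_sub_left (hfx x hx) (hfx y hy),
    intervalIntegral.integral_interval_sub_left (hfx x hx).norm (hfx y hy).norm]
  exact intervalIntegral.norm_integral_le_abs_integral_norm

lemma sub_eq_integral_of_absolutelyContinuous [CompleteSpace E] {f f' : ℝ → E} {a b : ℝ}
    (hf : AbsolutelyContinuousOnInterval f a b) (hf' : IntervalIntegrable f' volume a b)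
    (hderiv : ∀ᵐ x, x ∈ uIcc a b → HasDerivAt f (f' x) x) :
    f b - f a = ∫ t in a..b, f' t := by
  have hzero : ∀ᵐ x, x ∈ uIcc a b → HasDerivAt (fun x => f x - ∫ t in a..x, f' t) 0 x := by
    filter_upwards [hderiv, hf'.ae_hasDerivAt_integral] with x hx hFx hxab
    simpa only [sub_self] using (hx hxab).fun_sub (hFx hxab a left_mem_uIcc)
  obtain ⟨C, hC⟩ := (hf.fun_sub
    (absolutelyContinuousOnInterval_integral hf')).const_of_ae_hasDerivAt_zero hzero
  have ha := hC a left_mem_uIcc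
  rw [intervalIntegral.integral_same, sub_zero] at ha
  rw [ha, ← hC b right_mem_uIcc, sub_sub_cancel]

/-- `f` is locally absolutely continuous on `]0,∞[`. -/
def LocallyAC (f : ℝ → F) : Prop :=
  ∀ a b : ℝ, 0 < a → a ≤ b → AbsolutelyContinuousOnInterval f a b

lemma uIcc_subset_Ioi_zero {a b : ℝ} (ha : 0 < a) (hb : 0 < b) : uIcc a b ⊆ Ioi 0 :=
  (convex_Ioi (0 : ℝ)).ordConnected.uIcc_subset ha hb

lemma ae_restrict_Ioi_zero {p : ℝ → Prop}
    (h : ∀ a b, 0 < a → a ≤ b → ∀ᵐ x, x ∈ Icc a b → p x) :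
    ∀ᵐ x ∂(volume.restrict (Ioi (0 : ℝ))), p x := by
  rw [ae_restrict_iff' measurableSet_Ioi]
  have hn : ∀ n : ℕ, ∀ᵐ x, x ∈ Icc (1 / ((n : ℝ) + 1)) (n + 1) → p x := fun n =>
    h _ _ (by positivity) ((div_le_one (by positivity)).2 (by linarith [n.cast_nonneg (α := ℝ)])
      |>.trans (by linarith [n.cast_nonneg (α := ℝ)]))
  filter_upwards [ae_all_iff.2 hn] with x hx hx0
  obtain ⟨n, hn⟩ := exists_nat_gt (max x (1 / x))
  have hx1 : 1 / x < n + 1 := (le_max_right _ _).trans_lt (hn.trans (lt_add_one _))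
  refine hx n ⟨?_, (le_max_left _ _).trans (hn.trans (lt_add_one _)).le⟩
  exact (div_le_comm₀ (by positivity) hx0).2 hx1.le

lemma hasDerivAt_integral_of_continuousOn_Ioi [CompleteSpace E] {f : ℝ → E}
    (hf : ContinuousOn f (Ioi 0)) {c x : ℝ} (hc : 0 < c) (hx : 0 < x) :
    HasDerivAt (fun y => ∫ t in c..y, f t) (f x) x :=
  intervalIntegral.integral_hasDerivAt_right
    (hf.mono (uIcc_subset_Ioi_zero hc hx)).intervalIntegrable
    (hf.stronglyMeasurableAtFilter isOpen_Ioi x hx) (hf.continuousAt (Ioi_mem_nhds hx))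

namespace LocallyAC

lemma absolutelyContinuousOnInterval {f : ℝ → F} (hf : LocallyAC f) {a b : ℝ} (ha : 0 < a)
    (hb : 0 < b) : AbsolutelyContinuousOnInterval f a b := by
  rcases le_total a b with hab | hab
  exacts [hf a b ha hab, (hf b a hb hab).symm]

lemma continuousOn {f : ℝ → F} (hf : LocallyAC f) : ContinuousOn f (Ioi 0) := by
  intro x (hx : 0 < x)
  have h := (hf (x / 2) (x + 1) (by linarith) (by linarith)).continuousOn
  rw [uIcc_of_le (by linarith)] at h
  exact (h.continuousAt (Icc_mem_nhds (by linarith) (by linarith))).continuousWithinAt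

lemma congr {f g : ℝ → F} (hf : LocallyAC f) (h : EqOn f g (Ioi 0)) : LocallyAC g := by
  refine fun a b ha hab => absolutelyContinuousOnInterval_of_dist_le (hf a b ha hab) ?_
  have hsub := uIcc_subset_Ioi_zero ha (ha.trans_le hab)
  intro x hx y hy
  rw [h (hsub hx), h (hsub hy)]

lemma sub {f g : ℝ → F} (hf : LocallyAC f) (hg : LocallyAC g) : LocallyAC fun x => f x - g x :=
  fun a b ha hab => (hf a b ha hab).fun_sub (hg a b ha hab)

lemma add {f g : ℝ → F} (hf : LocallyAC f) (hg : LocallyAC g) : LocallyAC fun x => f x + g x :=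
  fun a b ha hab => (hf a b ha hab).fun_add (hg a b ha hab)

lemma mul {R : Type*} [NormedDivisionRing R] {f g : ℝ → R} (hf : LocallyAC f)
    (hg : LocallyAC g) : LocallyAC fun x => f x * g x :=
  fun a b ha hab => (hf a b ha hab).fun_smul (hg a b ha hab)

lemma of_hasDerivAt {f f' : ℝ → E} (hf : ∀ x, 0 < x → HasDerivAt f (f' x) x)
    (hf' : ContinuousOn f' (Ioi 0)) : LocallyAC f := by
  intro a b ha hab
  have hsub := uIcc_subset_Ioi_zero ha (ha.trans_le hab)
  obtain ⟨C, hC⟩ := isCompact_uIcc.exists_bound_of_continuousOn (hf'.mono hsub)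
  have hLip : LipschitzOnWith C.toNNReal f (uIcc a b) := by
    refine (convex_uIcc a b).lipschitzOnWith_of_nnnorm_hasDerivWithin_le
      (fun x hx => (hf x (hsub hx)).hasDerivWithinAt) fun x hx => ?_
    rw [← norm_toNNReal]
    exact Real.toNNReal_le_toNNReal (hC x hx)
  exact hLip.absolutelyContinuousOnInterval

lemma ae_differentiableAt [FiniteDimensional ℝ E] {f : ℝ → E} (hf : LocallyAC f) :
    ∀ᵐ x ∂(volume.restrict (Ioi (0 : ℝ))), DifferentiableAt ℝ f x := by
  refine ae_restrict_Ioi_zero fun a b ha hab => ?_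
  rw [← uIcc_of_le hab]
  exact (hf a b ha hab).boundedVariationOn.ae_differentiableAt_of_mem_uIcc

lemma sub_eq_integral [CompleteSpace E] {f f' : ℝ → E} (hf : LocallyAC f) {a b : ℝ}
    (ha : 0 < a) (hb : 0 < b) (hf' : IntervalIntegrable f' volume a b)
    (hderiv : ∀ᵐ x ∂(volume.restrict (Ioi (0 : ℝ))), HasDerivAt f (f' x) x) :
    f b - f a = ∫ t in a..b, f' t := by
  refine sub_eq_integral_of_absolutelyContinuous (hf.absolutelyContinuousOnInterval ha hb) hf' ?_
  filter_upwards [(ae_restrict_iff' measurableSet_Ioi).1 hderiv] with x hx hxab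
  exact hx (uIcc_subset_Ioi_zero ha hb hxab)

lemma hasDerivAt_of_ae [CompleteSpace E] {f f' : ℝ → E} (hf : LocallyAC f)
    (hf' : ContinuousOn f' (Ioi 0))
    (hderiv : ∀ᵐ x ∂(volume.restrict (Ioi (0 : ℝ))), HasDerivAt f (f' x) x) {x : ℝ}
    (hx : 0 < x) : HasDerivAt f (f' x) x := by
  have hint : ∀ y, 0 < y → IntervalIntegrable f' volume x y := fun y hy =>
    (hf'.mono (uIcc_subset_Ioi_zero hx hy)).intervalIntegrable
  refine ((hasDerivAt_integral_of_continuousOn_Ioi hf' hx hx).const_add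
    (f x)).congr_of_eventuallyEq ?_
  filter_upwards [Ioi_mem_nhds hx] with y hy
  rw [← hf.sub_eq_integral hx hy (hint y hy) hderiv, add_sub_cancel]

end LocallyAC

lemma locallyAC_integral {f : ℝ → E} (hf : LocallyIntegrableOn f (Ioi (0 : ℝ))) {c : ℝ}
    (hc : 0 < c) : LocallyAC fun x => ∫ t in c..x, f t := by
  have hint : ∀ a b, 0 < a → 0 < b → IntervalIntegrable f volume a b := fun a b ha hb =>
    (hf.integrableOn_compact_subset (uIcc_subset_Ioi_zero ha hb)
      isCompact_uIcc).intervalIntegrable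
  intro a b ha hab
  have hb := ha.trans_le hab
  refine absolutelyContinuousOnInterval_of_dist_le
    (absolutelyContinuousOnInterval_integral (hint a b ha hb)) fun x hx y hy => ?_
  have hpos := uIcc_subset_Ioi_zero ha hb
  rw [dist_eq_norm, dist_eq_norm, intervalIntegral.integral_interval_sub_left
    (hint c x hc (hpos hx)) (hint c y hc (hpos hy)), intervalIntegral.integral_interval_sub_left
    (hint a x ha (hpos hx)) (hint a y ha (hpos hy))]

end AbsolutelyContinuous

/-! ### The Schur test on `L^∞` -/

section Schur

variable {X : Type*} [MeasurableSpace X] {μ : Measure X} {K : X → X → ℂ} {θ : ℝ≥0}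

/-- The hypothesis of the Schur test on `L^∞(μ)`: the functions `K x` are integrable, with
`L¹`-norm at most `θ`. -/
structure IsSchurKernel (μ : Measure X) (K : X → X → ℂ) (θ : ℝ≥0) : Prop where
  aestronglyMeasurable : AEStronglyMeasurable (fun p : X × X => K p.1 p.2) (μ.prod μ)
  integrable : ∀ᵐ x ∂μ, Integrable (K x) μ
  integral_norm_le : ∀ᵐ x ∂μ, ∫ y, ‖K x y‖ ∂μ ≤ θ

namespace IsSchurKernel

lemma ae_norm_integral_mul_le (hK : IsSchurKernel μ K θ) {u : X → ℂ} (hu : MemLp u ∞ μ) :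
    ∀ᵐ x ∂μ, ‖∫ y, K x y * u y ∂μ‖ ≤ θ * (eLpNorm u ∞ μ).toReal := by
  have hu_le : ∀ᵐ y ∂μ, ‖u y‖ ≤ (eLpNorm u ∞ μ).toReal := by
    rw [eLpNorm_exponent_top]
    filter_upwards [ae_le_eLpNormEssSup (f := u) (μ := μ)] with y hy
    rw [← toReal_enorm]
    exact ENNReal.toReal_mono (by simpa only [eLpNorm_exponent_top] using hu.2.ne) hy
  filter_upwards [hK.integrable, hK.integral_norm_le] with x hint hle
  calc ‖∫ y, K x y * u y ∂μ‖ ≤ ∫ y, ‖K x y‖ * (eLpNorm u ∞ μ).toReal ∂μ := by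
        refine norm_integral_le_of_norm_le (hint.norm.mul_const _) ?_
        filter_upwards [hu_le] with y hy
        rw [norm_mul]
        gcongr
    _ ≤ θ * (eLpNorm u ∞ μ).toReal := by
        rw [integral_mul_const]
        gcongr

lemma eLpNorm_integral_mul_le (hK : IsSchurKernel μ K θ) {u : X → ℂ} (hu : MemLp u ∞ μ) :
    eLpNorm (fun x => ∫ y, K x y * u y ∂μ) ∞ μ ≤ θ * eLpNorm u ∞ μ := by
  rw [eLpNorm_exponent_top]
  refine (eLpNormEssSup_le_of_ae_bound (hK.ae_norm_integral_mul_le hu)).trans_eq ?_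
  rw [ENNReal.ofReal_mul θ.coe_nonneg, ENNReal.ofReal_toReal hu.2.ne, ENNReal.ofReal_coe_nnreal]

variable [SFinite μ]

lemma memLp_integral_mul (hK : IsSchurKernel μ K θ) {u : X → ℂ} (hu : MemLp u ∞ μ) :
    MemLp (fun x => ∫ y, K x y * u y ∂μ) ∞ μ :=
  memLp_top_of_bound (hK.aestronglyMeasurable.mul hu.1.comp_snd).integral_prod_right' _
    (hK.ae_norm_integral_mul_le hu)

/-- The bounded operator on `L^∞(μ)` with kernel `K`. -/
def toCLM (hK : IsSchurKernel μ K θ) : Lp ℂ ∞ μ →L[ℂ] Lp ℂ ∞ μ :=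
  LinearMap.mkContinuous
    { toFun u := (hK.memLp_integral_mul (Lp.memLp u)).toLp
      map_add' u v := by
        rw [← MemLp.toLp_add, MemLp.toLp_eq_toLp_iff]
        filter_upwards [hK.integrable] with x hx
        have hxu := hx.mul_of_top_left (Lp.memLp u)
        have hxv := hx.mul_of_top_left (Lp.memLp v)
        refine (integral_congr_ae ?_).trans (integral_add hxu hxv)
        filter_upwards [Lp.coeFn_add u v] with y hy
        rw [hy, Pi.add_apply, mul_add]
      map_smul' c u := by
        rw [RingHom.id_apply, ← MemLp.toLp_const_smul, MemLp.toLp_eq_toLp_iff]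
        refine .of_forall fun x => ?_
        rw [Pi.smul_apply, ← integral_smul]
        refine integral_congr_ae ?_
        filter_upwards [Lp.coeFn_smul c u] with y hy
        rw [hy, Pi.smul_apply, mul_smul_comm] }
    θ fun u => by
      have h := ENNReal.toReal_mono
        (ENNReal.mul_ne_top ENNReal.coe_ne_top (Lp.memLp u).2.ne)
        (hK.eLpNorm_integral_mul_le (Lp.memLp u))
      rwa [ENNReal.toReal_mul, ENNReal.coe_toReal, ← Lp.norm_def,
        ← Lp.norm_toLp _ (hK.memLp_integral_mul (Lp.memLp u))] at h

lemma toCLM_toLp (hK : IsSchurKernel μ K θ) {u : X → ℂ} (hu : MemLp u ∞ μ) :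
    hK.toCLM hu.toLp = (hK.memLp_integral_mul hu).toLp :=
  MemLp.toLp_congr (hK.memLp_integral_mul (Lp.memLp _)) _ <| .of_forall fun x =>
    integral_congr_ae <| by
      filter_upwards [hu.coeFn_toLp] with y hy
      rw [hy]

lemma one_add_toCLM_toLp (hK : IsSchurKernel μ K θ) {u : X → ℂ} (hu : MemLp u ∞ μ) :
    (1 + hK.toCLM) hu.toLp = (hu.add (hK.memLp_integral_mul hu)).toLp := by
  rw [add_apply, one_apply_eq_self, hK.toCLM_toLp hu, MemLp.toLp_add]

lemma isUnit_one_add_toCLM (hK : IsSchurKernel μ K θ) (hθ : θ < 1) : IsUnit (1 + hK.toCLM) := by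
  have hnorm : ‖-hK.toCLM‖ < 1 := by
    rw [norm_neg]
    exact (LinearMap.mkContinuous_norm_le _ θ.2 _).trans_lt hθ
  simpa only [sub_neg_eq_add] using isUnit_one_sub_of_norm_lt_one hnorm

lemma ae_eq_of_add_integral_mul_ae_eq (hK : IsSchurKernel μ K θ) (hθ : θ < 1) {u v : X → ℂ}
    (hu : MemLp u ∞ μ) (hv : MemLp v ∞ μ)
    (h : ∀ᵐ x ∂μ, u x + ∫ y, K x y * u y ∂μ = v x + ∫ y, K x y * v y ∂μ) : u =ᵐ[μ] v := by
  obtain ⟨S, hS⟩ := hK.isUnit_one_add_toCLM hθ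
  have hinj : Function.Injective ((1 + hK.toCLM :) : Lp ℂ ∞ μ → Lp ℂ ∞ μ) := by
    rw [← hS]
    exact (ContinuousLinearEquiv.ofUnit S).injective
  rw [← MemLp.toLp_eq_toLp_iff hu hv]
  refine hinj ?_
  rw [hK.one_add_toCLM_toLp hu, hK.one_add_toCLM_toLp hv, MemLp.toLp_eq_toLp_iff]
  exact h

lemma exists_add_integral_mul_ae_eq (hK : IsSchurKernel μ K θ) (hθ : θ < 1) :
    ∃ C : ℝ≥0, ∀ v : X → ℂ, MemLp v ∞ μ → ∃ u : X → ℂ, MemLp u ∞ μ ∧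
      eLpNorm u ∞ μ ≤ C * eLpNorm v ∞ μ ∧ ∀ᵐ x ∂μ, u x + ∫ y, K x y * u y ∂μ = v x := by
  obtain ⟨S, hS⟩ := hK.isUnit_one_add_toCLM hθ
  set R : Lp ℂ ∞ μ →L[ℂ] Lp ℂ ∞ μ := S.inv
  refine ⟨‖R‖₊, fun v hv => ⟨R hv.toLp, Lp.memLp _, ?_, ?_⟩⟩
  · have h := R.le_opENorm hv.toLp
    rwa [Lp.enorm_def, Lp.enorm_toLp] at h
  · have h : (1 + hK.toCLM) (R hv.toLp) = hv.toLp := by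
      rw [← hS]
      exact (ContinuousLinearEquiv.ofUnit S).apply_symm_apply _
    rw [← Lp.toLp_coeFn (R hv.toLp) (Lp.memLp _), hK.one_add_toCLM_toLp,
      MemLp.toLp_eq_toLp_iff] at h
    exact h

end IsSchurKernel

end Schur

/-! ### Kernel operators on weighted `L^∞` spaces -/

section Weighted

variable {a : ℝ} {φ ψ : ℝ → ℝ} {K : ℝ → ℝ → ℂ} {θ : ℝ≥0}

/-- `φ` is an a.e. measurable positive weight on `]a,∞[`. -/
structure IsWeight (a : ℝ) (φ : ℝ → ℝ) : Prop where
  aemeasurable : AEMeasurable φ (volume.restrict (Ioi a))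
  pos : ∀ x, a < x → 0 < φ x

lemma IsWeight.ofReal_ne_zero (hφ : IsWeight a φ) {x : ℝ} (hx : a < x) : (φ x : ℂ) ≠ 0 := by
  exact_mod_cast (hφ.pos x hx).ne'

lemma IsWeight.aestronglyMeasurable_ofReal (hφ : IsWeight a φ) :
    AEStronglyMeasurable (fun x => (φ x : ℂ)) (volume.restrict (Ioi a)) :=
  (Complex.measurable_ofReal.comp_aemeasurable hφ.aemeasurable).aestronglyMeasurable

lemma isWeight_of_continuousOn (hφ : ContinuousOn φ (Ioi a)) (hpos : ∀ x, a < x → 0 < φ x) :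
    IsWeight a φ :=
  ⟨hφ.aemeasurable measurableSet_Ioi, hpos⟩

lemma IsWeight.mul (hφ : IsWeight a φ) (hψ : IsWeight a ψ) : IsWeight a fun x => φ x * ψ x :=
  ⟨hφ.aemeasurable.mul hψ.aemeasurable, fun x hx => mul_pos (hφ.pos x hx) (hψ.pos x hx)⟩

lemma MemWeighted.memLp {f : ℝ → ℂ} (hf : MemWeighted a φ f) :
    MemLp (fun x => f x / (φ x : ℂ)) ∞ (volume.restrict (Ioi a)) :=
  hf

lemma MemWeighted.ae_norm_le (hφ : IsWeight a φ) {f : ℝ → ℂ} (hf : MemWeighted a φ f) :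
    ∀ᵐ x ∂(volume.restrict (Ioi a)), ‖f x‖ ≤ (weightedNorm a φ f).toReal * φ x := by
  rw [weightedNorm, eLpNorm_exponent_top]
  filter_upwards [ae_le_eLpNormEssSup (f := fun x => f x / (φ x : ℂ)),
    ae_restrict_mem measurableSet_Ioi] with x hx hax
  have hle := ENNReal.toReal_mono (by simpa only [eLpNorm_exponent_top] using hf.memLp.2.ne) hx
  rwa [toReal_enorm, norm_div, Complex.norm_real, Real.norm_of_nonneg (hφ.pos x hax).le,
    div_le_iff₀ (hφ.pos x hax)] at hle

lemma MemWeighted.aestronglyMeasurable (hφ : IsWeight a φ) {f : ℝ → ℂ} (hf : MemWeighted a φ f) :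
    AEStronglyMeasurable f (volume.restrict (Ioi a)) := by
  refine (hf.memLp.1.mul hφ.aestronglyMeasurable_ofReal).congr ?_
  filter_upwards [ae_restrict_mem measurableSet_Ioi] with x hx
  exact div_mul_cancel₀ (f x) (hφ.ofReal_ne_zero hx)

lemma memWeighted_of_ae_norm_le (hφ : IsWeight a φ) {f : ℝ → ℂ}
    (hf : AEStronglyMeasurable f (volume.restrict (Ioi a))) {M : ℝ}
    (hM : ∀ᵐ x ∂(volume.restrict (Ioi a)), ‖f x‖ ≤ M * φ x) : MemWeighted a φ f := by
  refine memLp_top_of_bound (hf.div₀ hφ.aestronglyMeasurable_ofReal) M ?_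
  filter_upwards [hM, ae_restrict_mem measurableSet_Ioi] with x hx hax
  rwa [norm_div, Complex.norm_real, Real.norm_of_nonneg (hφ.pos x hax).le,
    div_le_iff₀ (hφ.pos x hax)]

lemma kernelOp_congr_ae {f g : ℝ → ℂ} (h : f =ᵐ[volume.restrict (Ioi a)] g) (x : ℝ) :
    kernelOp a K f x = kernelOp a K g x :=
  integral_congr_ae <| by
    filter_upwards [h] with y hy
    rw [hy]

/-- The hypothesis of the Schur test on `L^∞(]a,∞[, φ)`. -/
structure SchurBound (a : ℝ) (φ : ℝ → ℝ) (K : ℝ → ℝ → ℂ) (θ : ℝ≥0) : Prop where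
  aestronglyMeasurable : AEStronglyMeasurable (fun p : ℝ × ℝ => K p.1 p.2)
    ((volume.restrict (Ioi a)).prod (volume.restrict (Ioi a)))
  integrable : ∀ x, a < x → IntegrableOn (fun y => K x y * φ y) (Ioi a)
  integral_le : ∀ x, a < x → ∫ y in Ioi a, ‖K x y‖ * φ y ≤ θ * φ x

namespace SchurBound

/-- Conjugating by the weight reduces to the unweighted space. -/
lemma isSchurKernel (hK : SchurBound a φ K θ) (hφ : IsWeight a φ) :
    IsSchurKernel (volume.restrict (Ioi a)) (fun x y => K x y * φ y / φ x) θ := by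
  have hφm := hφ.aestronglyMeasurable_ofReal
  refine ⟨(hK.aestronglyMeasurable.mul hφm.comp_snd).div₀ hφm.comp_fst, ?_, ?_⟩
  · filter_upwards [ae_restrict_mem measurableSet_Ioi] with x hx
    exact (hK.integrable x hx).div_const _
  · filter_upwards [ae_restrict_mem measurableSet_Ioi] with x hx
    have hnorm : ∫ y in Ioi a, ‖K x y * φ y / φ x‖ = (∫ y in Ioi a, ‖K x y‖ * φ y) / φ x := by
      rw [← integral_div]
      refine setIntegral_congr_fun measurableSet_Ioi fun y hy => ?_
      simp only [norm_div, norm_mul, Complex.norm_real, Real.norm_of_nonneg (hφ.pos x hx).le,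
        Real.norm_of_nonneg (hφ.pos y hy).le]
    rw [hnorm, div_le_iff₀ (hφ.pos x hx)]
    exact hK.integral_le x hx

lemma integrableOn_mul (hK : SchurBound a φ K θ) (hφ : IsWeight a φ) {f : ℝ → ℂ}
    (hf : MemWeighted a φ f) {x : ℝ} (hx : a < x) :
    IntegrableOn (fun y => K x y * f y) (Ioi a) := by
  refine ((hK.integrable x hx).mul_of_top_left hf.memLp).congr ?_
  filter_upwards [ae_restrict_mem measurableSet_Ioi] with y hy
  have := hφ.ofReal_ne_zero hy
  simp only [Pi.mul_apply]
  field_simp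

end SchurBound

lemma kernelOp_div_weight (hφ : IsWeight a φ) (f : ℝ → ℂ) (x : ℝ) :
    kernelOp a K f x / φ x = ∫ y in Ioi a, K x y * φ y / φ x * (f y / φ y) := by
  rw [kernelOp, ← integral_div]
  refine setIntegral_congr_fun measurableSet_Ioi fun y hy => ?_
  have := hφ.ofReal_ne_zero hy
  field_simp

theorem SchurBound.oneAddInvertible (hK : SchurBound a φ K θ) (hφ : IsWeight a φ) (hθ : θ < 1) :
    OneAddInvertible a φ K where
  integrable f hf x hx := hK.integrableOn_mul hφ hf hx
  bounded := by
    have hS := hK.isSchurKernel hφ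
    refine ⟨θ, fun f hf => ?_⟩
    rw [MemWeighted, weightedNorm, funext (kernelOp_div_weight hφ f)]
    exact ⟨hS.memLp_integral_mul hf.memLp, hS.eLpNorm_integral_mul_le hf.memLp⟩
  injective g₁ g₂ h₁ h₂ h := by
    have hdiv := (hK.isSchurKernel hφ).ae_eq_of_add_integral_mul_ae_eq hθ h₁.memLp h₂.memLp <| by
      filter_upwards [h] with x hx
      rw [← kernelOp_div_weight hφ, ← kernelOp_div_weight hφ, ← add_div, ← add_div, hx]
    filter_upwards [hdiv, ae_restrict_mem measurableSet_Ioi] with x hx hax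
    exact (div_left_inj' (hφ.ofReal_ne_zero hax)).1 hx
  surjective := by
    obtain ⟨C, hC⟩ := (hK.isSchurKernel hφ).exists_add_integral_mul_ae_eq hθ
    refine ⟨C, fun f hf => ?_⟩
    obtain ⟨u, hu, hle, hsol⟩ := hC _ hf.memLp
    have hdiv : (fun x => u x * φ x / φ x) =ᵐ[volume.restrict (Ioi a)] u := by
      filter_upwards [ae_restrict_mem measurableSet_Ioi] with x hx
      exact mul_div_cancel_right₀ _ (hφ.ofReal_ne_zero hx)
    refine ⟨fun x => u x * φ x, (memLp_congr_ae hdiv).2 hu,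
      (eLpNorm_congr_ae hdiv).trans_le hle, ?_⟩
    filter_upwards [hsol, hdiv, ae_restrict_mem measurableSet_Ioi] with x hx hxdiv hax
    rw [← div_left_inj' (hφ.ofReal_ne_zero hax), ← hx, add_div, kernelOp_div_weight hφ, hxdiv]
    congr 1
    refine integral_congr_ae ?_
    filter_upwards [hdiv] with y hy
    rw [hy]

lemma OneAddInvertible.exists_add_kernelOp_eq (h : OneAddInvertible a φ K) {f : ℝ → ℂ}
    (hf : MemWeighted a φ f) :
    ∃ g, MemWeighted a φ g ∧ ∀ x, a < x → g x + kernelOp a K g x = f x := by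
  obtain ⟨_, hsurj⟩ := h.surjective
  obtain ⟨g, hg, -, hgf⟩ := hsurj f hf
  have hae : (fun x => f x - kernelOp a K g x) =ᵐ[volume.restrict (Ioi a)] g := by
    filter_upwards [hgf] with x hx
    rw [← hx, add_sub_cancel_right]
  refine ⟨fun x => f x - kernelOp a K g x, hg.memLp.ae_eq ?_, fun x _ => ?_⟩
  · filter_upwards [hae] with x hx
    rw [hx]
  · rw [kernelOp_congr_ae hae, sub_add_cancel]

lemma weightedNorm_le_of_weight_le (hφ : IsWeight a φ) {B : ℝ≥0}
    (hle : ∀ x, a < x → φ x ≤ B * ψ x) (f : ℝ → ℂ) :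
    weightedNorm a ψ f ≤ B * weightedNorm a φ f := by
  refine eLpNorm_le_nnreal_smul_eLpNorm_of_ae_le_mul ?_ ∞
  filter_upwards [ae_restrict_mem measurableSet_Ioi] with x hx
  have hφx := hφ.pos x hx
  have hψx : 0 < ψ x := pos_of_mul_pos_right (hφx.trans_le (hle x hx)) B.2
  rw [← NNReal.coe_le_coe, NNReal.coe_mul, coe_nnnorm, coe_nnnorm, norm_div, norm_div,
    Complex.norm_real, Complex.norm_real, Real.norm_of_nonneg hφx.le, Real.norm_of_nonneg hψx.le,
    div_le_iff₀ hψx]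
  calc ‖f x‖ = ‖f x‖ / φ x * φ x := (div_mul_cancel₀ _ hφx.ne').symm
    _ ≤ ‖f x‖ / φ x * (B * ψ x) := by gcongr; exact hle x hx
    _ = B * (‖f x‖ / φ x) * ψ x := by ring

lemma MemWeighted.of_weight_le (hφ : IsWeight a φ) (hψ : IsWeight a ψ) {B : ℝ≥0}
    (hle : ∀ x, a < x → φ x ≤ B * ψ x) {f : ℝ → ℂ} (hf : MemWeighted a φ f) :
    MemWeighted a ψ f :=
  ⟨(hf.aestronglyMeasurable hφ).div₀ hψ.aestronglyMeasurable_ofReal,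
    (weightedNorm_le_of_weight_le hφ hle f).trans_lt (ENNReal.mul_lt_top (by simp) hf.2)⟩

theorem OneAddInvertible.of_equivalent_weight (h : OneAddInvertible a φ K) (hφ : IsWeight a φ)
    (hψ : IsWeight a ψ) {B D : ℝ≥0} (hB : ∀ x, a < x → φ x ≤ B * ψ x)
    (hD : ∀ x, a < x → ψ x ≤ D * φ x) : OneAddInvertible a ψ K := by
  have hφψ : ∀ {f}, MemWeighted a φ f → MemWeighted a ψ f := fun hf => hf.of_weight_le hφ hψ hB
  have hψφ : ∀ {f}, MemWeighted a ψ f → MemWeighted a φ f := fun hf => hf.of_weight_le hψ hφ hD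
  have hnorm : ∀ (C : ℝ≥0) (f g : ℝ → ℂ), weightedNorm a φ g ≤ C * weightedNorm a φ f →
      weightedNorm a ψ g ≤ (B * C * D : ℝ≥0) * weightedNorm a ψ f := by
    intro C f g hfg
    calc weightedNorm a ψ g ≤ B * weightedNorm a φ g := weightedNorm_le_of_weight_le hφ hB g
      _ ≤ B * (C * (D * weightedNorm a ψ f)) := by
        gcongr
        exact hfg.trans (by gcongr; exact weightedNorm_le_of_weight_le hψ hD f)
      _ = (B * C * D : ℝ≥0) * weightedNorm a ψ f := by push_cast; ring
  obtain ⟨C, hC⟩ := h.bounded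
  obtain ⟨C', hC'⟩ := h.surjective
  refine ⟨fun f hf => h.integrable f (hψφ hf), ⟨B * C * D, fun f hf => ?_⟩,
    fun g₁ g₂ h₁ h₂ => h.injective g₁ g₂ (hψφ h₁) (hψφ h₂), ⟨B * C' * D, fun f hf => ?_⟩⟩
  · exact ⟨hφψ (hC f (hψφ hf)).1, hnorm _ _ _ (hC f (hψφ hf)).2⟩
  · obtain ⟨g, hg, hle, heq⟩ := hC' f (hψφ hf)
    exact ⟨g, hφψ hg, hnorm _ _ _ hle, heq⟩

end Weighted

/-! ### Solutions of second order linear equations -/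

section LinearODE

/-- `h` is a twice differentiable solution of `h'' = V h` on `]0,∞[`. -/
def IsClassical (V h : ℝ → ℂ) : Prop :=
  ∀ x, 0 < x → HasDerivAt h (deriv h x) x ∧ HasDerivAt (deriv h) (V x * h x) x

namespace IsClassical

variable {V f g : ℝ → ℂ}

lemma of_hasDerivAt {f' : ℝ → ℂ} (hf : ∀ x, 0 < x → HasDerivAt f (f' x) x)
    (hf' : ∀ x, 0 < x → HasDerivAt f' (V x * f x) x) : IsClassical V f := by
  refine fun x hx => ⟨(hf x hx).differentiableAt.hasDerivAt,
    (hf' x hx).congr_of_eventuallyEq ?_⟩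
  filter_upwards [Ioi_mem_nhds hx] with y hy
  exact (hf y hy).deriv

lemma continuousOn (hf : IsClassical V f) : ContinuousOn f (Ioi 0) :=
  fun x hx => (hf x hx).1.continuousAt.continuousWithinAt

lemma continuousOn_deriv (hf : IsClassical V f) : ContinuousOn (deriv f) (Ioi 0) :=
  fun x hx => (hf x hx).2.continuousAt.continuousWithinAt

lemma wronskian_eq (hf : IsClassical V f) (hg : IsClassical V g) {x y : ℝ} (hx : 0 < x)
    (hy : 0 < y) : wronskian f g x = wronskian f g y := by
  have hderiv : ∀ x, 0 < x → HasDerivAt (wronskian f g) 0 x := fun x hx =>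
    (((hf x hx).1.fun_mul (hg x hx).2).fun_sub
      ((hf x hx).2.fun_mul (hg x hx).1)).congr_deriv (by ring)
  exact isOpen_Ioi.is_const_of_deriv_eq_zero isPreconnected_Ioi
    (fun x hx => (hderiv x hx).differentiableAt.differentiableWithinAt)
    (fun x hx => (hderiv x hx).deriv) hx hy

lemma linear_combination (hf : IsClassical V f) (hg : IsClassical V g) (α β : ℂ) :
    IsClassical V fun x => α * f x + β * g x := by
  refine of_hasDerivAt
    (fun x hx => ((hf x hx).1.const_mul α).fun_add ((hg x hx).1.const_mul β)) fun x hx => ?_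
  exact (((hf x hx).2.const_mul α).fun_add ((hg x hx).2.const_mul β)).congr_deriv (by ring)

end IsClassical

end LinearODE

section BesselEquation

variable {Q f : ℝ → ℂ} {m k : ℂ}

lemma IsAC1.hasDerivAt (hf : IsAC1 f) {x : ℝ} (hx : 0 < x) : HasDerivAt f (deriv f x) x :=
  (hf.1.differentiableAt (Ioi_mem_nhds hx)).hasDerivAt

lemma IsAC1.continuousOn (hf : IsAC1 f) : ContinuousOn f (Ioi 0) :=
  hf.1.continuousOn

lemma IsAC1.locallyAC_deriv (hf : IsAC1 f) : LocallyAC (deriv f) :=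
  hf.2

/-- The coefficient of the unperturbed equation in the form `f'' = V f`. -/
def besselCoeff (m k : ℂ) (x : ℝ) : ℂ :=
  k ^ 2 + (m ^ 2 - 1 / 4) / (x : ℂ) ^ 2

lemma continuousOn_besselCoeff (m k : ℂ) : ContinuousOn (besselCoeff m k) (Ioi 0) := by
  refine continuousOn_const.add (continuousOn_const.div (by fun_prop) fun x hx => ?_)
  exact pow_ne_zero 2 (Complex.ofReal_ne_zero.2 (ne_of_gt hx))

lemma isSolution_iff : IsSolution Q m k f ↔ IsAC1 f ∧
    ∀ᵐ x ∂(volume.restrict (Ioi (0 : ℝ))),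
      deriv (deriv f) x = (besselCoeff m k x + Q x) * f x := by
  refine and_congr_right fun _ => eventually_congr <| .of_forall fun x => ?_
  rw [besselOp, besselCoeff]
  constructor <;> intro h <;> linear_combination -h

lemma IsSolution.isAC1 (hf : IsSolution Q m k f) : IsAC1 f :=
  hf.1

lemma IsSolution.ae_hasDerivAt_deriv (hf : IsSolution Q m k f) :
    ∀ᵐ x ∂(volume.restrict (Ioi (0 : ℝ))),
      HasDerivAt (deriv f) ((besselCoeff m k x + Q x) * f x) x := by
  filter_upwards [(isSolution_iff.1 hf).2, hf.isAC1.locallyAC_deriv.ae_differentiableAt]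
    with x heq hdiff
  exact heq ▸ hdiff.hasDerivAt

lemma IsClassical.isSolution (hf : IsClassical (besselCoeff m k) f) : IsSolution 0 m k f := by
  refine isSolution_iff.2 ⟨⟨fun x hx => (hf x hx).1.differentiableAt.differentiableWithinAt,
    LocallyAC.of_hasDerivAt (fun x hx => (hf x hx).2)
      ((continuousOn_besselCoeff m k).mul hf.continuousOn)⟩, ?_⟩
  filter_upwards [ae_restrict_mem measurableSet_Ioi] with x hx
  rw [(hf x hx).2.deriv, Pi.zero_apply, add_zero]

lemma IsSolution.isClassical (hf : IsSolution 0 m k f) : IsClassical (besselCoeff m k) f := by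
  refine fun x hx => ⟨hf.isAC1.hasDerivAt hx, hf.isAC1.locallyAC_deriv.hasDerivAt_of_ae
    ((continuousOn_besselCoeff m k).mul hf.isAC1.continuousOn) ?_ hx⟩
  filter_upwards [hf.ae_hasDerivAt_deriv] with x hx
  simpa only [Pi.mul_apply, Pi.zero_apply, add_zero] using hx

end BesselEquation

/-! ### Volterra kernels -/

section Volterra

variable {a : ℝ} {φ q : ℝ → ℝ} {K : ℝ → ℝ → ℂ}

lemma SchurBound.of_support {θ : ℝ≥0} {e : ℝ → ℝ} {S : ℝ → Set ℝ} (hφ : IsWeight a φ)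
    (he : IsWeight a e) (hK : AEStronglyMeasurable (fun p : ℝ × ℝ => K p.1 p.2)
      ((volume.restrict (Ioi a)).prod (volume.restrict (Ioi a))))
    (hKx : ∀ x, a < x → AEStronglyMeasurable (K x) (volume.restrict (Ioi a)))
    (hS : ∀ x, a < x → MeasurableSet (S x)) (hSa : ∀ x, a < x → S x ⊆ Ioi a)
    (hsupp : ∀ x, a < x → ∀ y ∉ S x, K x y = 0)
    (hle : ∀ x, a < x → ∀ y ∈ S x, ‖K x y‖ * φ y ≤ φ x * q y)
    (hint : ∀ x, a < x → IntegrableOn (fun y => q y * e y) (S x))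
    (hqe : ∀ x, a < x → ∫ y in S x, q y * e y ≤ θ * e x) :
    SchurBound a (fun x => φ x * e x) K θ := by
  have hdom : ∀ x, a < x → IntegrableOn ((S x).indicator fun y => φ x * (q y * e y)) (Ioi a) :=
    fun x hx => ((integrable_indicator_iff (hS x hx)).2 ((hint x hx).const_mul _)).integrableOn
  have hbound : ∀ x, a < x → ∀ y ∈ Ioi a,
      ‖K x y‖ * (φ y * e y) ≤ (S x).indicator (fun y => φ x * (q y * e y)) y := by
    intro x hx y hy
    by_cases hyS : y ∈ S x
    · rw [indicator_of_mem hyS, ← mul_assoc, ← mul_assoc]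
      exact mul_le_mul_of_nonneg_right (hle x hx y hyS) (he.pos y hy).le
    · rw [indicator_of_notMem hyS, hsupp x hx y hyS, norm_zero, zero_mul]
  have hnorm : ∀ x y, y ∈ Ioi a →
      ‖K x y * ((φ y * e y : ℝ) : ℂ)‖ = ‖K x y‖ * (φ y * e y) := fun x y hy => by
    rw [norm_mul, Complex.norm_real, Real.norm_of_nonneg ((hφ.mul he).pos y hy).le]
  have hKint : ∀ x, a < x → IntegrableOn (fun y => K x y * ((φ y * e y : ℝ) : ℂ)) (Ioi a) := by
    refine fun x hx => (hdom x hx).mono'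
      ((hKx x hx).mul (hφ.mul he).aestronglyMeasurable_ofReal) ?_
    filter_upwards [ae_restrict_mem measurableSet_Ioi] with y hy
    exact (hnorm x y hy).trans_le (hbound x hx y hy)
  refine ⟨hK, hKint, fun x hx => ?_⟩
  calc ∫ y in Ioi a, ‖K x y‖ * (φ y * e y)
      ≤ ∫ y in Ioi a, (S x).indicator (fun y => φ x * (q y * e y)) y := by
        refine setIntegral_mono_on ?_ (hdom x hx) measurableSet_Ioi (hbound x hx)
        exact IntegrableOn.congr_fun (hKint x hx).norm (hnorm x) measurableSet_Ioi
    _ = φ x * ∫ y in S x, q y * e y := by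
        rw [setIntegral_indicator (hS x hx), inter_eq_self_of_subset_right (hSa x hx),
          integral_const_mul]
    _ ≤ θ * (φ x * e x) := by
        rw [mul_left_comm]
        exact mul_le_mul_of_nonneg_left (hqe x hx) (hφ.pos x hx).le

lemma integral_mul_exp_mul_integral {b : ℝ} (hq : IntervalIntegrable q volume a b) (c : ℝ) :
    c * ∫ y in a..b, q y * Real.exp (c * ∫ t in a..y, q t) =
      Real.exp (c * ∫ t in a..b, q t) - 1 := by
  set P : ℝ → ℝ := fun y => ∫ t in a..y, q t
  have hP : AbsolutelyContinuousOnInterval P a b := absolutelyContinuousOnInterval_integral hq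
  obtain ⟨D, hD⟩ := hP.exists_bound
  obtain ⟨L, hL⟩ : ∃ L : ℝ≥0, LipschitzOnWith L (fun s => Real.exp (c * s)) (Icc (-D) D) :=
    (ContDiff.contDiffOn (by fun_prop)).exists_lipschitzOnWith one_ne_zero (convex_Icc _ _)
      isCompact_Icc
  have hderiv : ∀ᵐ y, y ∈ uIcc a b →
      HasDerivAt (fun y => Real.exp (c * P y)) (c * (q y * Real.exp (c * P y))) y := by
    filter_upwards [hq.ae_hasDerivAt_integral] with y hy hyab
    exact ((hy hyab a left_mem_uIcc).const_mul c).exp.congr_deriv (by ring)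
  have hint : IntervalIntegrable (fun y => q y * Real.exp (c * P y)) volume a b :=
    hq.mul_continuousOn (hP.continuousOn.const_smul c).rexp
  have hFTC := sub_eq_integral_of_absolutelyContinuous
    (absolutelyContinuousOnInterval_of_dist_le_mul hP L fun x hx y hy =>
      hL.dist_le_mul _ (abs_le.1 (hD x hx)) _ (abs_le.1 (hD y hy))) (hint.const_mul c) hderiv
  rw [← intervalIntegral.integral_const_mul, ← hFTC]
  simp only [P, intervalIntegral.integral_same, mul_zero, Real.exp_zero]

lemma continuousOn_integral_Ioi {E : Type*} [NormedAddCommGroup E] [NormedSpace ℝ E] {f : ℝ → E}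
    (hf : IntegrableOn f (Ioi a)) : ContinuousOn (fun x => ∫ t in Ioi x, f t) (Ici a) := by
  have hprim : Continuous fun x => ∫ t in a..x, (Ioi a).indicator f t :=
    ((integrable_indicator_iff measurableSet_Ioi).2 hf).continuous_primitive a
  refine (continuous_const.sub hprim).continuousOn.congr
    (f := fun x => (∫ t in Ioi a, f t) - ∫ t in a..x, (Ioi a).indicator f t)
    fun x (hx : a ≤ x) => ?_
  rw [← intervalIntegral.integral_interval_add_Ioi hf (hf.mono_set (Ioi_subset_Ioi hx)),
    eq_sub_iff_add_eq', add_left_inj]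
  refine intervalIntegral.integral_congr_uIoo fun t ht => indicator_of_mem ?_ f
  exact (uIoo_of_le hx ▸ ht).1

lemma integrableOn_mul_exp_integral_Ioi (hq : IntegrableOn q (Ioi a)) (c : ℝ) :
    IntegrableOn (fun y => q y * Real.exp (c * ∫ t in Ioi y, q t)) (Ioi a) := by
  refine hq.mul_bdd (c := Real.exp (|c| * ∫ t in Ioi a, ‖q t‖)) ?_ ?_
  · exact ((((continuousOn_integral_Ioi hq).const_smul c).rexp).mono
      Ioi_subset_Ici_self).aestronglyMeasurable measurableSet_Ioi
  · filter_upwards [ae_restrict_mem measurableSet_Ioi] with y (hy : a < y)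
    rw [Real.norm_of_nonneg (Real.exp_pos _).le, Real.exp_le_exp]
    calc c * ∫ t in Ioi y, q t ≤ |c| * ‖∫ t in Ioi y, q t‖ :=
          (le_abs_self _).trans_eq (abs_mul _ _)
      _ ≤ |c| * ∫ t in Ioi a, ‖q t‖ := by
          gcongr
          exact (norm_integral_le_integral_norm _).trans (setIntegral_mono_set hq.norm
            (.of_forall fun t => norm_nonneg _) (Ioi_subset_Ioi hy.le).eventuallyLE)

lemma mul_integral_mul_exp_integral_Ioi (hq : IntegrableOn q (Ioi a)) (c : ℝ) :
    c * ∫ y in Ioi a, q y * Real.exp (c * ∫ t in Ioi y, q t) =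
      Real.exp (c * ∫ t in Ioi a, q t) - 1 := by
  set T : ℝ := ∫ t in Ioi a, q t
  have htail : ∀ y, a ≤ y → (∫ t in a..y, -q t) + T = ∫ t in Ioi y, q t := fun y hy => by
    rw [intervalIntegral.integral_neg, ← intervalIntegral.integral_Ioi_sub_Ioi hq hy]
    ring
  have hpartial : ∀ R, a ≤ R → c * ∫ y in a..R, q y * Real.exp (c * ∫ t in Ioi y, q t) =
      Real.exp (c * T) - Real.exp (c * ∫ t in Ioi R, q t) := by
    intro R hR
    have hqR : IntervalIntegrable q volume a R :=
      (intervalIntegrable_iff_integrableOn_Ioc_of_le hR).2 (hq.mono_set Ioc_subset_Ioi_self)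
    have hrev := integral_mul_exp_mul_integral (q := fun t => -q t) hqR.neg c
    have hpull : ∫ y in a..R, q y * Real.exp (c * ∫ t in Ioi y, q t) =
        -Real.exp (c * T) * ∫ y in a..R, -q y * Real.exp (c * ∫ t in a..y, -q t) := by
      rw [← intervalIntegral.integral_const_mul]
      refine intervalIntegral.integral_congr fun y hy => ?_
      rw [← htail y (uIcc_of_le hR ▸ hy).1, mul_add, Real.exp_add]
      ring
    rw [hpull, mul_left_comm, hrev, ← htail R hR, mul_add, Real.exp_add]
    ring
  refine tendsto_nhds_unique ((intervalIntegral_tendsto_integral_Ioi a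
    (integrableOn_mul_exp_integral_Ioi hq c) tendsto_id).const_mul c) ?_
  have htail_zero := tendsto_integral_Ioi_zero (f := q) (μ := volume) tendsto_id
  have hlim := (htail_zero.const_mul c).rexp.const_sub (Real.exp (c * T))
  rw [mul_zero, Real.exp_zero] at hlim
  refine hlim.congr' ?_
  filter_upwards [eventually_ge_atTop a] with R hR
  exact (hpartial R hR).symm

theorem oneAddInvertible_of_backward_volterra (hφ : IsWeight a φ)
    (hK : AEStronglyMeasurable (fun p : ℝ × ℝ => K p.1 p.2)
      ((volume.restrict (Ioi a)).prod (volume.restrict (Ioi a))))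
    (hKx : ∀ x, a < x → AEStronglyMeasurable (K x) (volume.restrict (Ioi a)))
    (hsupp : ∀ x, a < x → ∀ y ≤ x, K x y = 0)
    (hle : ∀ x, a < x → ∀ y, x < y → ‖K x y‖ * φ y ≤ φ x * q y)
    (hq : IntegrableOn q (Ioi a)) : OneAddInvertible a φ K := by
  have hq0 : ∀ y, a < y → 0 ≤ q y := fun y hy => by
    obtain ⟨x, hax, hxy⟩ := exists_between hy
    exact nonneg_of_mul_nonneg_right
      ((mul_nonneg (norm_nonneg _) (hφ.pos y hy).le).trans (hle x hax y hxy)) (hφ.pos x hax)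
  have htail0 : ∀ x, a ≤ x → 0 ≤ ∫ t in Ioi x, q t := fun x hx =>
    setIntegral_nonneg measurableSet_Ioi fun y hy => hq0 y (hx.trans_lt hy)
  have htail_le : ∀ x, a < x → ∫ t in Ioi x, q t ≤ ∫ t in Ioi a, q t := fun x hx =>
    setIntegral_mono_set hq ((ae_restrict_mem measurableSet_Ioi).mono hq0)
      (Ioi_subset_Ioi hx.le).eventuallyLE
  set e : ℝ → ℝ := fun x => Real.exp (2 * ∫ t in Ioi x, q t)
  have he : IsWeight a e := isWeight_of_continuousOn
    (((continuousOn_integral_Ioi hq).const_smul (2 : ℝ)).rexp.mono Ioi_subset_Ici_self)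
    fun x _ => Real.exp_pos _
  have hhalf : ∀ x, a < x → ∫ y in Ioi x, q y * e y ≤ (1 / 2 : ℝ≥0) * e x := by
    intro x hx
    have hexp := mul_integral_mul_exp_integral_Ioi (hq.mono_set (Ioi_subset_Ioi hx.le)) 2
    change _ ≤ (1 / 2 : ℝ) * e x
    linarith
  have hSchur : SchurBound a (fun x => φ x * e x) K (1 / 2) :=
    .of_support hφ he hK hKx (fun x _ => measurableSet_Ioi) (fun x hx => Ioi_subset_Ioi hx.le)
      (fun x hx y hy => hsupp x hx y (notMem_Ioi.1 hy)) hle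
      (fun x hx => integrableOn_mul_exp_integral_Ioi (hq.mono_set (Ioi_subset_Ioi hx.le)) 2) hhalf
  refine (hSchur.oneAddInvertible (hφ.mul he) (by norm_num)).of_equivalent_weight (hφ.mul he) hφ
    (B := ⟨Real.exp (2 * ∫ t in Ioi a, q t), (Real.exp_pos _).le⟩) (D := 1) (fun x hx => ?_)
    fun x hx => ?_
  · rw [mul_comm]
    exact mul_le_mul_of_nonneg_right (Real.exp_le_exp.2 (by linarith [htail_le x hx]))
      (hφ.pos x hx).le
  · rw [NNReal.coe_one, one_mul]
    exact le_mul_of_one_le_right (hφ.pos x hx).le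
      (Real.one_le_exp (mul_nonneg zero_le_two (htail0 x hx.le)))

end Volterra

/-! ### The initial value problem -/

section InitialValueProblem

lemma integral_uIoc_mul_exp_abs_integral {q : ℝ → ℝ} (hq0 : ∀ y, 0 ≤ q y) {a x : ℝ}
    (hq : IntervalIntegrable q volume a x) (c : ℝ) :
    c * ∫ y in uIoc a x, q y * Real.exp (c * |∫ t in a..y, q t|) =
      Real.exp (c * |∫ t in a..x, q t|) - 1 := by
  rcases le_total a x with hax | hxa
  · have habs : ∀ y, a ≤ y → |∫ t in a..y, q t| = ∫ t in a..y, q t := fun y hy =>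
      abs_of_nonneg (intervalIntegral.integral_nonneg_of_forall hy hq0)
    rw [habs x hax, ← integral_mul_exp_mul_integral hq, uIoc_of_le hax,
      ← intervalIntegral.integral_of_le hax]
    congr 1
    refine intervalIntegral.integral_congr fun y hy => ?_
    rw [habs y (uIcc_of_le hax ▸ hy).1]
  · have habs : ∀ y ≤ a, |∫ t in a..y, q t| = ∫ t in a..y, -q t := fun y hy => by
      rw [intervalIntegral.integral_symm, abs_neg, abs_of_nonneg
        (intervalIntegral.integral_nonneg_of_forall hy hq0), intervalIntegral.integral_neg,
        intervalIntegral.integral_symm a]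
    rw [habs x hxa, ← integral_mul_exp_mul_integral (q := fun t => -q t) hq.neg,
      uIoc_of_ge hxa, ← intervalIntegral.integral_of_le hxa, intervalIntegral.integral_symm a,
      ← intervalIntegral.integral_neg]
    congr 1
    refine intervalIntegral.integral_congr fun y hy => ?_
    rw [habs y (uIcc_of_ge hxa ▸ hy).2, neg_mul]

lemma MemWeighted.locallyIntegrableOn {φ : ℝ → ℝ} (hφ : ContinuousOn φ (Ioi 0))
    (hpos : ∀ x, 0 < x → 0 < φ x) {f : ℝ → ℂ} (hf : MemWeighted 0 φ f) :
    LocallyIntegrableOn f (Ioi 0) := by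
  have hw := isWeight_of_continuousOn hφ hpos
  refine (locallyIntegrableOn_iff isOpen_Ioi.isLocallyClosed).2 fun s hs hsc => ?_
  refine Integrable.mono' (((hφ.mono hs).integrableOn_compact hsc).const_mul
    (weightedNorm 0 φ f).toReal) ((hf.aestronglyMeasurable hw).mono_set hs) ?_
  exact ae_restrict_of_ae_restrict_of_subset hs (hf.ae_norm_le hw)

variable {V : ℝ → ℂ}

/-- The kernel of the Volterra operator `f ↦ -∫ y in 1..x, (x - y) V(y) f(y)` attached to the
initial value problem at `1`. On both sides of `1` the sign of `x - y` matches the orientation of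
the integral, so that the kernel has one expression for all `x > 0`. -/
def initialKernel (V : ℝ → ℂ) (x y : ℝ) : ℂ :=
  -(uIoc 1 x).indicator (fun y => (|x - y| : ℝ) * V y) y

lemma kernelOp_initialKernel (f : ℝ → ℂ) {x : ℝ} (hx : 0 < x) :
    kernelOp 0 (initialKernel V) f x = -∫ y in (1 : ℝ)..x, ((x : ℂ) - y) * (V y * f y) := by
  have hmul : ∀ y, initialKernel V x y * f y =
      -(uIoc 1 x).indicator (fun y => ((|x - y| : ℝ) : ℂ) * (V y * f y)) y := fun y => by
    rw [initialKernel, neg_mul, ← indicator_mul_left]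
    simp only [mul_assoc]
  rw [kernelOp]
  simp only [hmul]
  rw [integral_neg, setIntegral_indicator measurableSet_uIoc, inter_eq_self_of_subset_right
    (uIoc_subset_uIcc.trans (uIcc_subset_Ioi_zero one_pos hx))]
  congr 1
  rcases le_total 1 x with h1 | h1
  · rw [intervalIntegral.integral_of_le h1, uIoc_of_le h1]
    refine setIntegral_congr_fun measurableSet_Ioc fun y hy => ?_
    rw [abs_of_nonneg (sub_nonneg.2 hy.2), Complex.ofReal_sub]
  · rw [intervalIntegral.integral_of_ge h1, uIoc_of_ge h1, ← integral_neg]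
    refine setIntegral_congr_fun measurableSet_Ioc fun y hy => ?_
    rw [abs_of_nonpos (sub_nonpos.2 hy.1.le), Complex.ofReal_neg, Complex.ofReal_sub, neg_mul]

lemma aestronglyMeasurable_initialKernel (hV : ContinuousOn V (Ioi 0)) :
    AEStronglyMeasurable (fun p : ℝ × ℝ => initialKernel V p.1 p.2)
      ((volume.restrict (Ioi 0)).prod (volume.restrict (Ioi 0))) := by
  have hS : MeasurableSet {p : ℝ × ℝ | p.2 ∈ uIoc 1 p.1} :=
    (measurableSet_lt (measurable_const.min measurable_fst) measurable_snd).inter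
      (measurableSet_le measurable_snd (measurable_const.max measurable_fst))
  have hcont : Continuous fun p : ℝ × ℝ => ((|p.1 - p.2| : ℝ) : ℂ) := by fun_prop
  exact ((hcont.aestronglyMeasurable.mul
    (hV.aestronglyMeasurable measurableSet_Ioi).comp_snd).indicator hS).neg

lemma aestronglyMeasurable_initialKernel_right (hV : ContinuousOn V (Ioi 0)) (x : ℝ) :
    AEStronglyMeasurable (initialKernel V x) (volume.restrict (Ioi 0)) := by
  have hcont : Continuous fun y : ℝ => ((|x - y| : ℝ) : ℂ) := by fun_prop
  exact ((hcont.aestronglyMeasurable.mul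
    (hV.aestronglyMeasurable measurableSet_Ioi)).indicator measurableSet_uIoc).neg

lemma exists_oneAddInvertible_initialKernel (hV : ContinuousOn V (Ioi 0)) :
    ∃ ψ : ℝ → ℝ, ContinuousOn ψ (Ioi 0) ∧ (∀ x, 0 < x → max 1 x ≤ ψ x) ∧
      OneAddInvertible 0 ψ (initialKernel V) := by
  set q : ℝ → ℝ := fun y => ‖V y‖ * max 1 y
  set e : ℝ → ℝ := fun x => Real.exp (2 * |∫ t in (1 : ℝ)..x, q t|)
  have hq0 : ∀ y, 0 ≤ q y := fun y => by positivity
  have hqc : ContinuousOn q (Ioi 0) := hV.norm.mul (by fun_prop)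
  have hqi : ∀ x, 0 < x → IntervalIntegrable q volume 1 x := fun x hx =>
    (hqc.mono (uIcc_subset_Ioi_zero one_pos hx)).intervalIntegrable
  have hec : ContinuousOn e (Ioi 0) :=
    ((locallyAC_integral (hqc.locallyIntegrableOn measurableSet_Ioi)
      one_pos).continuousOn.abs.const_smul (2 : ℝ)).rexp
  have hφ : IsWeight 0 fun x => max 1 x :=
    isWeight_of_continuousOn (by fun_prop) fun x _ => by positivity
  have he : IsWeight 0 e := isWeight_of_continuousOn hec fun x _ => Real.exp_pos _
  have hSub : ∀ x : ℝ, 0 < x → uIcc 1 x ⊆ Ioi 0 := fun x hx => uIcc_subset_Ioi_zero one_pos hx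
  have hle : ∀ x, 0 < x → ∀ y ∈ uIoc 1 x, ‖initialKernel V x y‖ * max 1 y ≤ max 1 x * q y := by
    intro x hx y hy
    have hy0 : 0 < y := hSub x hx (uIoc_subset_uIcc hy)
    have hxy : |x - y| ≤ max 1 x := abs_le.2
      ⟨by linarith [hy.2, show y ≤ max 1 x from hy.2], by linarith [le_max_right 1 x]⟩
    rw [initialKernel, norm_neg, indicator_of_mem hy, norm_mul, Complex.norm_real,
      Real.norm_of_nonneg (abs_nonneg _), mul_assoc]
    exact mul_le_mul_of_nonneg_right hxy (hq0 y)
  have hhalf : ∀ x, 0 < x → ∫ y in uIoc 1 x, q y * e y ≤ (1 / 2 : ℝ≥0) * e x := by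
    intro x hx
    have hexp := integral_uIoc_mul_exp_abs_integral hq0 (hqi x hx) 2
    change _ ≤ (1 / 2 : ℝ) * e x
    linarith
  have hSchur : SchurBound 0 (fun x => max 1 x * e x) (initialKernel V) (1 / 2) :=
    .of_support hφ he (aestronglyMeasurable_initialKernel hV)
      (fun x _ => aestronglyMeasurable_initialKernel_right hV x) (fun x _ => measurableSet_uIoc)
      (fun x hx => uIoc_subset_uIcc.trans (hSub x hx))
      (fun x _ y hy => by rw [initialKernel, indicator_of_notMem hy, neg_zero]) hle
      (fun x hx => ((((hqc.mul hec).mono (hSub x hx)).integrableOn_compact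
        isCompact_uIcc).mono_set uIoc_subset_uIcc)) hhalf
  refine ⟨fun x => max 1 x * e x, ContinuousOn.mul (by fun_prop) hec, fun x _ => ?_,
    hSchur.oneAddInvertible (hφ.mul he) (by norm_num)⟩
  exact le_mul_of_one_le_right (by positivity) (Real.one_le_exp (by positivity))

lemma exists_continuousOn_eq_add_integral (hV : ContinuousOn V (Ioi 0)) (α β : ℂ) :
    ∃ h : ℝ → ℂ, ContinuousOn h (Ioi 0) ∧ ∀ x, 0 < x → h x = α + β * (x - 1) +
      (x * (∫ y in (1 : ℝ)..x, V y * h y) - ∫ y in (1 : ℝ)..x, y * (V y * h y)) := by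
  obtain ⟨ψ, hψc, hψ, hinv⟩ := exists_oneAddInvertible_initialKernel hV
  have hψpos : ∀ x, 0 < x → 0 < ψ x := fun x hx => one_pos.trans_le
    ((le_max_left _ _).trans (hψ x hx))
  have hdata : MemWeighted 0 ψ fun x => α + β * ((x : ℂ) - 1) := by
    refine memWeighted_of_ae_norm_le (isWeight_of_continuousOn hψc hψpos)
      (Continuous.aestronglyMeasurable (by fun_prop)) (M := ‖α‖ + ‖β‖) ?_
    filter_upwards [ae_restrict_mem measurableSet_Ioi] with x (hx : 0 < x)
    have hx1 : ‖(x : ℂ) - 1‖ ≤ max 1 x := by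
      rw [← Complex.ofReal_one, ← Complex.ofReal_sub, Complex.norm_real, Real.norm_eq_abs, abs_le]
      exact ⟨by linarith [le_max_left 1 x], by linarith [le_max_right 1 x]⟩
    calc ‖α + β * ((x : ℂ) - 1)‖ ≤ ‖α‖ * 1 + ‖β‖ * ‖(x : ℂ) - 1‖ := by
          rw [mul_one, ← norm_mul]
          exact norm_add_le _ _
      _ ≤ (‖α‖ + ‖β‖) * ψ x := by
          rw [add_mul]
          gcongr
          exacts [(le_max_left _ _).trans (hψ x hx), hx1.trans (hψ x hx)]
  obtain ⟨h, hh, heq⟩ := hinv.exists_add_kernelOp_eq hdata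
  have hVh : LocallyIntegrableOn (fun y => V y * h y) (Ioi 0) :=
    (hh.locallyIntegrableOn hψc hψpos).continuousOn_mul hV isOpen_Ioi.isLocallyClosed
  have hyVh : LocallyIntegrableOn (fun y : ℝ => (y : ℂ) * (V y * h y)) (Ioi 0) :=
    hVh.continuousOn_mul (by fun_prop) isOpen_Ioi.isLocallyClosed
  have hrep : ∀ x, 0 < x → h x = α + β * (x - 1) +
      (x * (∫ y in (1 : ℝ)..x, V y * h y) - ∫ y in (1 : ℝ)..x, y * (V y * h y)) := by
    intro x hx
    have hint : ∀ {f : ℝ → ℂ}, LocallyIntegrableOn f (Ioi 0) → IntervalIntegrable f volume 1 x :=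
      fun hf => (hf.integrableOn_compact_subset (uIcc_subset_Ioi_zero one_pos hx)
        isCompact_uIcc).intervalIntegrable
    rw [← heq x hx, kernelOp_initialKernel h hx, ← intervalIntegral.integral_const_mul,
      ← intervalIntegral.integral_sub ((hint hVh).const_mul _) (hint hyVh)]
    simp only [sub_mul, neg_add_cancel_right]
  refine ⟨h, ContinuousOn.congr ?_ hrep, hrep⟩
  have hI := (locallyAC_integral hVh one_pos).continuousOn
  have hJ := (locallyAC_integral hyVh one_pos).continuousOn
  fun_prop

theorem exists_isClassical_initial (hV : ContinuousOn V (Ioi 0)) (α β : ℂ) :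
    ∃ h, IsClassical V h ∧ h 1 = α ∧ deriv h 1 = β := by
  obtain ⟨h, hc, hrep⟩ := exists_continuousOn_eq_add_integral hV α β
  have hI : ∀ x, 0 < x → HasDerivAt (fun x : ℝ => ∫ y in (1 : ℝ)..x, V y * h y) (V x * h x) x :=
    fun x hx => hasDerivAt_integral_of_continuousOn_Ioi (hV.mul hc) one_pos hx
  have hJ : ∀ x, 0 < x →
      HasDerivAt (fun x : ℝ => ∫ y in (1 : ℝ)..x, (y : ℂ) * (V y * h y)) (x * (V x * h x)) x :=
    fun x hx => hasDerivAt_integral_of_continuousOn_Ioi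
      (Complex.continuous_ofReal.continuousOn.mul (hV.mul hc)) one_pos hx
  have hid : ∀ x : ℝ, HasDerivAt (fun x : ℝ => (x : ℂ)) 1 x := fun _ =>
    Complex.ofRealCLM.hasDerivAt
  have hderiv : ∀ x, 0 < x → HasDerivAt h (β + ∫ y in (1 : ℝ)..x, V y * h y) x := by
    intro x hx
    refine ((((((hid x).sub_const 1).const_mul β).const_add α).fun_add
      (((hid x).fun_mul (hI x hx)).fun_sub (hJ x hx))).congr_deriv (by ring)).congr_of_eventuallyEq
      ?_
    filter_upwards [Ioi_mem_nhds hx] with y hy using hrep y hy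
  refine ⟨h, .of_hasDerivAt hderiv fun x hx => (hI x hx).const_add β, ?_, ?_⟩
  · rw [hrep 1 one_pos]
    simp
  · rw [(hderiv 1 one_pos).deriv, intervalIntegral.integral_same, add_zero]

end InitialValueProblem

section FundamentalPair

variable (m k : ℂ)

lemma exists_isFundamentalPair : ∃ h, IsFundamentalPair m k h := by
  obtain ⟨h₁, c₁, e₁, d₁⟩ := exists_isClassical_initial (continuousOn_besselCoeff m k) 1 0
  obtain ⟨h₂, c₂, e₂, d₂⟩ := exists_isClassical_initial (continuousOn_besselCoeff m k) 0 1
  refine ⟨(h₁, h₂), c₁.isSolution, c₂.isSolution, ?_⟩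
  simp [wronskian, e₁, e₂, d₁, d₂]

lemma isFundamentalPair_fundamentalPair : IsFundamentalPair m k (fundamentalPair m k) :=
  Classical.epsilon_spec (exists_isFundamentalPair m k)

lemma isClassical_fundamentalPair_fst : IsClassical (besselCoeff m k) (fundamentalPair m k).1 :=
  (isFundamentalPair_fundamentalPair m k).1.isClassical

lemma isClassical_fundamentalPair_snd : IsClassical (besselCoeff m k) (fundamentalPair m k).2 :=
  (isFundamentalPair_fundamentalPair m k).2.1.isClassical

lemma wronskian_fundamentalPair_ne_zero :
    wronskian (fundamentalPair m k).1 (fundamentalPair m k).2 1 ≠ 0 :=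
  (isFundamentalPair_fundamentalPair m k).2.2

lemma wronskian_fundamentalPair {x : ℝ} (hx : 0 < x) :
    wronskian (fundamentalPair m k).1 (fundamentalPair m k).2 x =
      wronskian (fundamentalPair m k).1 (fundamentalPair m k).2 1 :=
  (isClassical_fundamentalPair_fst m k).wronskian_eq (isClassical_fundamentalPair_snd m k) hx
    one_pos

end FundamentalPair

/-! ### Growth of the solutions of the unperturbed equation -/

section Growth

/-- The energy `‖h'‖² + ‖k h‖²`, whose logarithmic derivative along `h'' = V h` is at most
`2 Re k + ‖V - k²‖ / ‖k‖`. -/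
def energy (k : ℂ) (h : ℝ → ℂ) (x : ℝ) : ℝ :=
  ‖deriv h x‖ ^ 2 + ‖k * h x‖ ^ 2

lemma norm_deriv_le_sqrt_energy (k : ℂ) (h : ℝ → ℂ) (x : ℝ) :
    ‖deriv h x‖ ≤ √(energy k h x) :=
  Real.le_sqrt_of_sq_le (le_add_of_nonneg_right (sq_nonneg _))

lemma norm_le_sqrt_energy {k : ℂ} (hk0 : k ≠ 0) (h : ℝ → ℂ) (x : ℝ) :
    ‖h x‖ ≤ ‖k‖⁻¹ * √(energy k h x) := by
  rw [le_inv_mul_iff₀ (norm_pos_iff.2 hk0), ← norm_mul]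
  exact Real.le_sqrt_of_sq_le (le_add_of_nonneg_left (sq_nonneg _))

lemma sqrt_energy_le_norm_add_norm (k : ℂ) (h : ℝ → ℂ) (x : ℝ) :
    √(energy k h x) ≤ (1 + ‖k‖) * (‖h x‖ + ‖deriv h x‖) := by
  calc √(energy k h x) ≤ √((‖deriv h x‖ + ‖k * h x‖) ^ 2) := by
        refine Real.sqrt_le_sqrt ?_
        rw [energy, add_sq, add_right_comm]
        exact le_add_of_nonneg_right (by positivity)
    _ = ‖deriv h x‖ + ‖k‖ * ‖h x‖ := by rw [Real.sqrt_sq (by positivity), norm_mul]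
    _ ≤ _ := by nlinarith [norm_nonneg k, norm_nonneg (h x), norm_nonneg (deriv h x)]

lemma inner_add_inner_le {k : ℂ} (hk : 0 ≤ k.re) (hk0 : k ≠ 0) (u v c : ℂ) :
    2 * inner ℝ v (c * u) + 2 * inner ℝ (k * u) (k * v) ≤
      (2 * k.re + ‖c - k ^ 2‖ / ‖k‖) * (‖v‖ ^ 2 + ‖k * u‖ ^ 2) := by
  have hamgm : 2 * (‖v‖ * ‖k * u‖) ≤ ‖v‖ ^ 2 + ‖k * u‖ ^ 2 := by
    linarith [two_mul_le_add_sq ‖v‖ ‖k * u‖]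
  have hsplit : 2 * inner ℝ v (c * u) + 2 * inner ℝ (k * u) (k * v) =
      2 * k.re * (2 * inner ℝ v (k * u)) + 2 * inner ℝ v ((c - k ^ 2) * u) := by
    simp only [Complex.inner, Complex.mul_re, Complex.mul_im, Complex.conj_re, Complex.conj_im,
      Complex.sub_re, Complex.sub_im, pow_two]
    ring
  have hpert : 2 * inner ℝ v ((c - k ^ 2) * u) ≤
      ‖c - k ^ 2‖ / ‖k‖ * (‖v‖ ^ 2 + ‖k * u‖ ^ 2) := by
    calc 2 * inner ℝ v ((c - k ^ 2) * u) ≤ 2 * (‖v‖ * ‖(c - k ^ 2) * u‖) := by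
          gcongr
          exact real_inner_le_norm _ _
      _ = ‖c - k ^ 2‖ / ‖k‖ * (2 * (‖v‖ * ‖k * u‖)) := by
          rw [norm_mul, norm_mul]
          field_simp [norm_ne_zero_iff.2 hk0]
      _ ≤ _ := by gcongr
  rw [hsplit, add_mul]
  gcongr
  exact (mul_le_mul_of_nonneg_left (real_inner_le_norm _ _) zero_le_two).trans hamgm

variable {V : ℝ → ℂ} {k : ℂ} {h : ℝ → ℂ}

lemma IsClassical.hasDerivAt_energy (hh : IsClassical V h) (k : ℂ) {x : ℝ} (hx : 0 < x) :
    HasDerivAt (energy k h)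
      (2 * inner ℝ (deriv h x) (V x * h x) + 2 * inner ℝ (k * h x) (k * deriv h x)) x :=
  (hh x hx).2.norm_sq.fun_add ((hh x hx).1.const_mul k).norm_sq

lemma IsClassical.energy_le (hh : IsClassical V h) (hV : ContinuousOn V (Ioi 0)) (hk : 0 ≤ k.re)
    (hk0 : k ≠ 0) {x y : ℝ} (hx : 0 < x) (hxy : x ≤ y) :
    energy k h y ≤
      energy k h x * Real.exp (∫ t in x..y, (2 * k.re + ‖V t - k ^ 2‖ / ‖k‖)) := by
  set r : ℝ → ℝ := fun t => 2 * k.re + ‖V t - k ^ 2‖ / ‖k‖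
  have hr : ContinuousOn r (Ioi 0) := by fun_prop
  set e : ℝ → ℝ := fun z => Real.exp (-∫ t in x..z, r t)
  have hderiv : ∀ z, 0 < z → HasDerivAt (fun z => energy k h z * e z)
      ((2 * inner ℝ (deriv h z) (V z * h z) + 2 * inner ℝ (k * h z) (k * deriv h z)) * e z +
        energy k h z * (e z * -r z)) z := fun _ hz =>
    (hh.hasDerivAt_energy k hz).fun_mul
      (hasDerivAt_integral_of_continuousOn_Ioi hr hx hz).fun_neg.exp
  have hanti : AntitoneOn (fun z => energy k h z * e z) (Ioi 0) := by
    refine antitoneOn_of_hasDerivWithinAt_nonpos (convex_Ioi 0)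
      (fun z hz => (hderiv z hz).continuousAt.continuousWithinAt)
      (fun z hz => (hderiv z (interior_subset hz)).hasDerivWithinAt) fun z _ => ?_
    have hle := mul_le_mul_of_nonneg_right (inner_add_inner_le hk hk0 (h z) (deriv h z) (V z))
      (Real.exp_pos (-∫ t in x..z, r t)).le
    simp only [energy, e, r] at hle ⊢
    linarith
  have hxy' := hanti hx (hx.trans_le hxy) hxy
  simp only [e, intervalIntegral.integral_same, neg_zero, Real.exp_zero, mul_one] at hxy'
  rwa [Real.exp_neg, ← div_eq_mul_inv, div_le_iff₀ (Real.exp_pos _)] at hxy'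

lemma IsClassical.sqrt_energy_le (hh : IsClassical V h) (hV : ContinuousOn V (Ioi 0))
    (hk : 0 ≤ k.re) (hk0 : k ≠ 0) {a : ℝ} (ha : 0 < a)
    (hint : IntegrableOn (fun x => V x - k ^ 2) (Ioi a)) {x y : ℝ} (hax : a ≤ x) (hxy : x ≤ y) :
    √(energy k h y) ≤ √(energy k h x) *
      (Real.exp ((y - x) * k.re) * Real.exp ((∫ t in Ioi a, ‖V t - k ^ 2‖ / ‖k‖) / 2)) := by
  have hI : IntegrableOn (fun t => ‖V t - k ^ 2‖ / ‖k‖) (Ioi a) := hint.norm.div_const _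
  have hsub : Ioc x y ⊆ Ioi a := Ioc_subset_Ioi_self.trans (Ioi_subset_Ioi hax)
  have hexp : ∫ t in x..y, (2 * k.re + ‖V t - k ^ 2‖ / ‖k‖) ≤
      2 * ((y - x) * k.re + (∫ t in Ioi a, ‖V t - k ^ 2‖ / ‖k‖) / 2) := by
    rw [intervalIntegral.integral_add intervalIntegrable_const
      ((intervalIntegrable_iff_integrableOn_Ioc_of_le hxy).2 (hI.mono_set hsub)),
      intervalIntegral.integral_const, smul_eq_mul, intervalIntegral.integral_of_le hxy]
    have := setIntegral_mono_set hI (.of_forall fun t => by positivity) hsub.eventuallyLE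
    linarith
  have hx0 : 0 ≤ energy k h x := add_nonneg (sq_nonneg _) (sq_nonneg _)
  rw [← Real.exp_add]
  refine Real.sqrt_le_iff.2 ⟨by positivity, ?_⟩
  rw [mul_pow, Real.sq_sqrt hx0, ← Real.exp_nat_mul]
  exact (hh.energy_le hV hk hk0 (ha.trans_le hax) hxy).trans
    (mul_le_mul_of_nonneg_left (Real.exp_le_exp.2 hexp) hx0)

theorem exists_growth_bound (hV : ContinuousOn V (Ioi 0)) (hk : 0 ≤ k.re) (hk0 : k ≠ 0) {a : ℝ}
    (ha : 0 < a) (hint : IntegrableOn (fun x => V x - k ^ 2) (Ioi a)) :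
    ∃ C : ℝ, ∀ h, IsClassical V h → ∀ x y, a ≤ x → x ≤ y →
      ‖h y‖ ≤ C * Real.exp ((y - x) * k.re) * (‖h x‖ + ‖deriv h x‖) ∧
      ‖deriv h y‖ ≤ C * Real.exp ((y - x) * k.re) * (‖h x‖ + ‖deriv h x‖) := by
  set E : ℝ := Real.exp ((∫ t in Ioi a, ‖V t - k ^ 2‖ / ‖k‖) / 2)
  refine ⟨(1 + ‖k‖⁻¹) * ((1 + ‖k‖) * E), fun h hh x y hax hxy => ?_⟩
  have hbound : (1 + ‖k‖⁻¹) * √(energy k h y) ≤ (1 + ‖k‖⁻¹) * ((1 + ‖k‖) * E) *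
      Real.exp ((y - x) * k.re) * (‖h x‖ + ‖deriv h x‖) := by
    calc (1 + ‖k‖⁻¹) * √(energy k h y)
        ≤ (1 + ‖k‖⁻¹) * ((1 + ‖k‖) * (‖h x‖ + ‖deriv h x‖) *
            (Real.exp ((y - x) * k.re) * E)) := by
          gcongr
          exact (hh.sqrt_energy_le hV hk hk0 ha hint hax hxy).trans
            (mul_le_mul_of_nonneg_right (sqrt_energy_le_norm_add_norm k h x) (by positivity))
      _ = _ := by ring
  rw [add_mul, one_mul] at hbound
  have hh0 := norm_le_sqrt_energy hk0 h y
  have hh1 := norm_deriv_le_sqrt_energy k h y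
  have hk1 : 0 ≤ ‖k‖⁻¹ * √(energy k h y) := by positivity
  constructor <;> linarith [Real.sqrt_nonneg (energy k h y)]

lemma integrableOn_besselCoeff_sub (m k : ℂ) {a : ℝ} (ha : 0 < a) :
    IntegrableOn (fun x => besselCoeff m k x - k ^ 2) (Ioi a) := by
  have hpow : IntegrableOn (fun x : ℝ => ((x ^ (-2 : ℝ) : ℝ) : ℂ)) (Ioi a) :=
    (integrableOn_Ioi_rpow_of_lt (by norm_num) ha).ofReal
  refine IntegrableOn.congr_fun (hpow.const_mul (m ^ 2 - 1 / 4)) (fun x hx => ?_)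
    measurableSet_Ioi
  rw [besselCoeff, add_sub_cancel_left, Real.rpow_neg (ha.trans hx).le, Real.rpow_two,
    Complex.ofReal_inv, Complex.ofReal_pow]
  exact (div_eq_mul_inv _ _).symm

end Growth

section CanonicalBisolution

variable (m k : ℂ)

/-- The derivative of the canonical bisolution in its first variable. -/
def canonicalBisolutionDeriv (x y : ℝ) : ℂ :=
  (deriv (fundamentalPair m k).1 x * (fundamentalPair m k).2 y -
      deriv (fundamentalPair m k).2 x * (fundamentalPair m k).1 y) /
    wronskian (fundamentalPair m k).1 (fundamentalPair m k).2 1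

lemma isClassical_fundamentalPair_combination (α β : ℂ) :
    IsClassical (besselCoeff m k) fun y =>
      (α * (fundamentalPair m k).2 y - β * (fundamentalPair m k).1 y) /
        wronskian (fundamentalPair m k).1 (fundamentalPair m k).2 1 := by
  set W := wronskian (fundamentalPair m k).1 (fundamentalPair m k).2 1
  convert (isClassical_fundamentalPair_snd m k).linear_combination
    (isClassical_fundamentalPair_fst m k) (α / W) (-β / W) using 2
  ring

lemma deriv_fundamentalPair_combination (α β : ℂ) {x : ℝ} (hx : 0 < x) :
    deriv (fun y => (α * (fundamentalPair m k).2 y - β * (fundamentalPair m k).1 y) /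
        wronskian (fundamentalPair m k).1 (fundamentalPair m k).2 1) x =
      (α * deriv (fundamentalPair m k).2 x - β * deriv (fundamentalPair m k).1 x) /
        wronskian (fundamentalPair m k).1 (fundamentalPair m k).2 1 :=
  ((((isClassical_fundamentalPair_snd m k x hx).1.const_mul α).fun_sub
    ((isClassical_fundamentalPair_fst m k x hx).1.const_mul β)).div_const _).deriv

lemma canonicalBisolution_self (x : ℝ) : canonicalBisolution m k x x = 0 := by
  rw [canonicalBisolution, mul_comm, sub_self, zero_div]

lemma deriv_canonicalBisolution_self {x : ℝ} (hx : 0 < x) :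
    deriv (canonicalBisolution m k x) x = 1 := by
  refine (deriv_fundamentalPair_combination m k _ _ hx).trans ?_
  rw [div_eq_one_iff_eq (wronskian_fundamentalPair_ne_zero m k), ← wronskian_fundamentalPair m k hx,
    wronskian]
  ring

lemma canonicalBisolutionDeriv_self {x : ℝ} (hx : 0 < x) :
    canonicalBisolutionDeriv m k x x = -1 := by
  rw [canonicalBisolutionDeriv, div_eq_iff (wronskian_fundamentalPair_ne_zero m k),
    ← wronskian_fundamentalPair m k hx, wronskian]
  ring

lemma deriv_canonicalBisolutionDeriv_self {x : ℝ} (hx : 0 < x) :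
    deriv (canonicalBisolutionDeriv m k x) x = 0 := by
  refine (deriv_fundamentalPair_combination m k _ _ hx).trans ?_
  rw [mul_comm, sub_self, zero_div]

end CanonicalBisolution

theorem exists_bisolution_bound (m : ℂ) {k : ℂ} (hk : 0 ≤ k.re) (hk0 : k ≠ 0) {a : ℝ}
    (ha : 0 < a) : ∃ C : ℝ, ∀ x y : ℝ, a ≤ x → x ≤ y →
      ‖canonicalBisolution m k x y‖ ≤ C * Real.exp ((y - x) * k.re) ∧
      ‖canonicalBisolutionDeriv m k x y‖ ≤ C * Real.exp ((y - x) * k.re) := by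
  obtain ⟨C, hC⟩ := exists_growth_bound (continuousOn_besselCoeff m k) hk hk0 ha
    (integrableOn_besselCoeff_sub m k ha)
  refine ⟨C, fun x y hax hxy => ⟨?_, ?_⟩⟩
  · have h := (hC (canonicalBisolution m k x)
      (isClassical_fundamentalPair_combination m k _ _) x y hax hxy).1
    simpa only [canonicalBisolution_self, deriv_canonicalBisolution_self m k (ha.trans_le hax),
      norm_zero, norm_one, zero_add, mul_one] using h
  · have h := (hC (canonicalBisolutionDeriv m k x)
      (isClassical_fundamentalPair_combination m k _ _) x y hax hxy).1
    simpa only [canonicalBisolutionDeriv_self m k (ha.trans_le hax),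
      deriv_canonicalBisolutionDeriv_self m k (ha.trans_le hax), norm_neg, norm_zero, norm_one,
      add_zero, mul_one] using h

/-! ### Holomorphic dependence of integrals on a parameter -/

section Parameter

variable {α E : Type*} [MeasurableSpace α] {μ : Measure α} [NormedAddCommGroup E]

lemma aestronglyMeasurable_of_ae_hasDerivAt {𝕜 : Type*} [NontriviallyNormedField 𝕜]
    [NormedSpace 𝕜 E] {f : 𝕜 → α → E} {f' : α → E} {z : 𝕜}
    (hm : ∀ᶠ w in 𝓝 z, AEStronglyMeasurable (f w) μ)
    (hd : ∀ᵐ v ∂μ, HasDerivAt (fun w => f w v) (f' v) z) : AEStronglyMeasurable f' μ := by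
  obtain ⟨u, hu⟩ := exists_seq_tendsto (𝓝[≠] z)
  obtain ⟨N, hN⟩ := eventually_atTop.1 (hu.eventually (hm.filter_mono nhdsWithin_le_nhds))
  refine aestronglyMeasurable_of_tendsto_ae atTop
    (f := fun n v => slope (fun w => f w v) z (u (n + N)))
    (fun n => ((hN _ (N.le_add_left n)).sub hm.self_of_nhds).const_smul (u (n + N) - z)⁻¹) ?_
  filter_upwards [hd] with v hv
  exact (hasDerivAt_iff_tendsto_slope.1 hv).comp (hu.comp (tendsto_add_atTop_nat N))

theorem hasDerivAt_integral_of_holomorphic [NormedSpace ℂ E] {U : Set ℂ} (hU : IsOpen U)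
    {f : ℂ → α → E} {b : α → ℝ} (hm : ∀ z ∈ U, AEStronglyMeasurable (f z) μ)
    (hb : Integrable b μ) (hle : ∀ᵐ v ∂μ, ∀ z ∈ U, ‖f z v‖ ≤ b v)
    (hd : ∀ᵐ v ∂μ, DifferentiableOn ℂ (fun z => f z v) U) {z : ℂ} (hz : z ∈ U) :
    HasDerivAt (fun z => ∫ v, f z v ∂μ) (∫ v, deriv (fun z => f z v) z ∂μ) z := by
  obtain ⟨r, hr, hball⟩ := Metric.isOpen_iff.1 hU z hz
  have hm' : ∀ᶠ w in 𝓝 z, AEStronglyMeasurable (f w) μ := (hU.eventually_mem hz).mono hm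
  have hderiv : ∀ᵐ v ∂μ, ∀ w ∈ U, HasDerivAt (fun z => f z v) (deriv (fun z => f z v) w) w :=
    hd.mono fun v hv w hw => (hv.differentiableAt (hU.mem_nhds hw)).hasDerivAt
  refine (hasDerivAt_integral_of_dominated_loc_of_deriv_le
    (F' := fun w v => deriv (fun z => f z v) w) (bound := fun v => b v / (r / 2))
    (Metric.ball_mem_nhds z (half_pos hr)) hm'
    (hb.mono' (hm z hz) (hle.mono fun v hv => hv z hz))
    (aestronglyMeasurable_of_ae_hasDerivAt hm' (hderiv.mono fun v hv => hv z hz)) ?_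
    (hb.div_const _) ?_).2
  · filter_upwards [hle, hd] with v hlev hdv w hw
    have hsub : Metric.closedBall w (r / 2) ⊆ U :=
      (Metric.closedBall_subset_ball' (by linarith [Metric.mem_ball.1 hw])).trans hball
    exact Complex.norm_deriv_le_of_forall_mem_sphere_norm_le (half_pos hr)
      (hdv.mono (Metric.closure_ball_subset_closedBall.trans hsub)).diffContOnCl
      fun y hy => hlev y (hsub (Metric.sphere_subset_closedBall hy))
  · filter_upwards [hderiv] with v hv w hw
    exact hv w (hball (Metric.ball_subset_ball (half_le_self hr.le) hw))

end Parameter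

/-! ### The integral formula of the Macdonald function -/

section MacdonaldIntegral

/-- The integrand of `2 K_m(z) = ∫ exp (-z cosh t - m t) dt`, which arises from the defining
integral by the substitution `s = exp t`. -/
def macdonaldIntegrand (m z : ℂ) (t : ℝ) : ℂ :=
  Complex.exp (-z * (Real.cosh t : ℂ) - m * t)

lemma macdonaldIntegral_eq (m z : ℂ) : macdonaldIntegral m z =
    z ^ (1 / 2 : ℂ) / (√(2 * Real.pi) : ℂ) * ∫ t : ℝ, macdonaldIntegrand m z t := by
  rw [macdonaldIntegral]
  congr 1
  have hsubst := integral_image_eq_integral_abs_deriv_smul (s := univ) (f := Real.exp)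
    MeasurableSet.univ (fun x _ => (Real.hasDerivAt_exp x).hasDerivWithinAt)
    Real.exp_injective.injOn
    fun s : ℝ => Complex.exp (-(z / 2) * ((s : ℂ) + (s : ℂ)⁻¹)) * (s : ℂ) ^ (-m - 1)
  rw [image_univ, Real.range_exp, setIntegral_univ] at hsubst
  rw [hsubst]
  congr 1
  funext t
  have hexp : ((Real.exp t : ℝ) : ℂ) ≠ 0 := by exact_mod_cast (Real.exp_pos t).ne'
  rw [abs_of_pos (Real.exp_pos t), Complex.real_smul, Complex.cpow_def_of_ne_zero hexp,
    ← Complex.ofReal_log (Real.exp_pos t).le, Real.log_exp, Complex.ofReal_exp, ← Complex.exp_neg,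
    ← Complex.exp_add, ← Complex.exp_add, macdonaldIntegrand, Complex.ofReal_cosh, Complex.cosh]
  ring_nf

lemma macdonaldIntegral_neg (m : ℂ) : macdonaldIntegral (-m) = macdonaldIntegral m := by
  funext z
  rw [macdonaldIntegral_eq, macdonaldIntegral_eq, ← integral_neg_eq_self]
  simp only [macdonaldIntegrand, Real.cosh_neg, Complex.ofReal_neg, neg_mul_neg]

lemma freeJost_neg (m : ℂ) : freeJost (-m) = freeJost m := by
  unfold freeJost macdonald
  rw [macdonaldIntegral_neg]

lemma sq_div_four_le_cosh (t : ℝ) : t ^ 2 / 4 ≤ Real.cosh t := by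
  rw [← Real.cosh_abs, Real.cosh_eq, ← sq_abs]
  linarith [abs_nonneg t, Real.quadratic_le_exp_of_nonneg (abs_nonneg t), Real.exp_pos (-|t|)]

lemma cosh_le_exp_abs (t : ℝ) : Real.cosh t ≤ Real.exp |t| := by
  rw [← Real.cosh_abs, Real.cosh_eq]
  linarith [Real.exp_le_exp.2 (neg_le_self (abs_nonneg t))]

lemma abs_sinh_le_cosh (t : ℝ) : |Real.sinh t| ≤ Real.cosh t := by
  rw [Real.abs_sinh, ← Real.cosh_abs]
  exact (Real.sinh_lt_cosh _).le

lemma integrable_exp_neg_sq_add_abs {d : ℝ} (hd : 0 < d) (M : ℝ) :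
    Integrable fun t : ℝ => Real.exp (-d * t ^ 2 + M * |t|) := by
  refine ((integrable_exp_neg_mul_sq (half_pos hd)).const_mul
    (Real.exp (M ^ 2 / (2 * d)))).mono' (by fun_prop) (.of_forall fun t => ?_)
  rw [Real.norm_of_nonneg (Real.exp_pos _).le, ← Real.exp_add, Real.exp_le_exp]
  have hsq : M ^ 2 / (2 * d) + -(d / 2) * t ^ 2 - (-d * t ^ 2 + M * |t|) =
      d / 2 * (M / d - |t|) ^ 2 := by
    rw [sub_sq, sq_abs]
    field_simp
    ring
  linarith [mul_nonneg (half_pos hd).le (sq_nonneg (M / d - |t|))]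

lemma integrable_exp_neg_cosh_add_abs {d : ℝ} (hd : 0 < d) (M : ℝ) :
    Integrable fun t : ℝ => Real.exp (-d * Real.cosh t + M * |t|) := by
  refine (integrable_exp_neg_sq_add_abs (div_pos hd zero_lt_four) M).mono' (by fun_prop)
    (.of_forall fun t => ?_)
  rw [Real.norm_of_nonneg (Real.exp_pos _).le, Real.exp_le_exp]
  nlinarith [sq_div_four_le_cosh t]

lemma continuous_macdonaldIntegrand (m z : ℂ) : Continuous (macdonaldIntegrand m z) := by
  unfold macdonaldIntegrand
  fun_prop

lemma continuous_cosh_pow_mul_macdonaldIntegrand (m z : ℂ) (n : ℕ) :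
    Continuous fun t : ℝ => (Real.cosh t : ℂ) ^ n * macdonaldIntegrand m z t := by
  have := continuous_macdonaldIntegrand m z
  fun_prop

lemma norm_macdonaldIntegrand_le {m z : ℂ} {d : ℝ} (hz : d ≤ z.re) (t : ℝ) :
    ‖macdonaldIntegrand m z t‖ ≤ Real.exp (-d * Real.cosh t + ‖m‖ * |t|) := by
  rw [macdonaldIntegrand, Complex.norm_exp, Real.exp_le_exp]
  have hm : -(m.re * t) ≤ ‖m‖ * |t| := by
    calc -(m.re * t) ≤ |m.re * t| := neg_le_abs _
      _ = |m.re| * |t| := abs_mul _ _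
      _ ≤ ‖m‖ * |t| := by
        gcongr
        exact Complex.abs_re_le_norm m
  simp only [Complex.sub_re, Complex.re_mul_ofReal, Complex.neg_re]
  nlinarith [Real.cosh_pos t]

lemma norm_cosh_pow_mul_macdonaldIntegrand_le {m z : ℂ} {d : ℝ} (hz : d ≤ z.re) (n : ℕ) (t : ℝ) :
    ‖(Real.cosh t : ℂ) ^ n * macdonaldIntegrand m z t‖ ≤
      Real.exp (-d * Real.cosh t + (n + ‖m‖) * |t|) := by
  rw [norm_mul, norm_pow, Complex.norm_real, Real.norm_of_nonneg (Real.cosh_pos t).le]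
  calc _ ≤ Real.exp |t| ^ n * Real.exp (-d * Real.cosh t + ‖m‖ * |t|) := by
        gcongr
        · exact cosh_le_exp_abs t
        · exact norm_macdonaldIntegrand_le hz t
    _ = _ := by
        rw [← Real.exp_nat_mul, ← Real.exp_add]
        ring_nf

lemma integrable_cosh_pow_mul_macdonaldIntegrand (m : ℂ) {z : ℂ} (hz : 0 < z.re) (n : ℕ) :
    Integrable fun t : ℝ => (Real.cosh t : ℂ) ^ n * macdonaldIntegrand m z t :=
  (integrable_exp_neg_cosh_add_abs hz (n + ‖m‖)).mono'
    (continuous_cosh_pow_mul_macdonaldIntegrand m z n).aestronglyMeasurable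
    (.of_forall fun t => norm_cosh_pow_mul_macdonaldIntegrand_le le_rfl n t)

/-- The integrals `∫ coshⁿ t exp (-z cosh t - m t) dt`; up to sign, the derivatives with respect
to `z` of the one with `n = 0`. -/
def macdonaldMoment (m : ℂ) (n : ℕ) (z : ℂ) : ℂ :=
  ∫ t : ℝ, (Real.cosh t : ℂ) ^ n * macdonaldIntegrand m z t

lemma macdonaldIntegral_eq_macdonaldMoment (m : ℂ) : macdonaldIntegral m =
    fun z => (√(2 * Real.pi) : ℂ)⁻¹ * (z ^ (1 / 2 : ℂ) * macdonaldMoment m 0 z) := by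
  funext z
  simp only [macdonaldIntegral_eq, macdonaldMoment, pow_zero, one_mul]
  ring

lemma hasDerivAt_macdonaldMoment (m : ℂ) (n : ℕ) {z : ℂ} (hz : 0 < z.re) :
    HasDerivAt (macdonaldMoment m n) (-macdonaldMoment m (n + 1) z) z := by
  have hderiv : ∀ (t : ℝ) (w : ℂ), HasDerivAt
      (fun w => (Real.cosh t : ℂ) ^ n * macdonaldIntegrand m w t)
      (-((Real.cosh t : ℂ) ^ (n + 1) * macdonaldIntegrand m w t)) w := by
    intro t w
    have hexponent : HasDerivAt (fun w : ℂ => -w * (Real.cosh t : ℂ) - m * t)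
        (-1 * (Real.cosh t : ℂ)) w :=
      (((hasDerivAt_id w).neg).mul_const _).sub_const _
    refine (hexponent.cexp.const_mul ((Real.cosh t : ℂ) ^ n)).congr_deriv ?_
    rw [macdonaldIntegrand]
    ring
  have h := hasDerivAt_integral_of_holomorphic (μ := volume) (U := {w : ℂ | z.re / 2 < w.re})
    (isOpen_lt continuous_const Complex.continuous_re)
    (f := fun w t => (Real.cosh t : ℂ) ^ n * macdonaldIntegrand m w t)
    (fun w _ => (continuous_cosh_pow_mul_macdonaldIntegrand m w n).aestronglyMeasurable)
    (integrable_exp_neg_cosh_add_abs (half_pos hz) _)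
    (.of_forall fun t w hw => norm_cosh_pow_mul_macdonaldIntegrand_le (le_of_lt hw) n t)
    (.of_forall fun t w _ => (hderiv t w).differentiableAt.differentiableWithinAt)
    (half_lt_self hz)
  simp only [(hderiv _ _).deriv, integral_neg] at h
  exact h

lemma hasDerivAt_sub_sinh_mul_macdonaldIntegrand (m z : ℂ) (t : ℝ) :
    HasDerivAt (fun t : ℝ => (m - z * (Real.sinh t : ℂ)) * macdonaldIntegrand m z t)
      (z ^ 2 * ((Real.cosh t : ℂ) ^ 2 * macdonaldIntegrand m z t) -
        z * ((Real.cosh t : ℂ) ^ 1 * macdonaldIntegrand m z t) -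
        (z ^ 2 + m ^ 2) * ((Real.cosh t : ℂ) ^ 0 * macdonaldIntegrand m z t)) t := by
  have hsinh := (Real.hasDerivAt_sinh t).ofReal_comp
  have hintegrand : HasDerivAt (macdonaldIntegrand m z)
      (macdonaldIntegrand m z t * (-z * (Real.sinh t : ℂ) - m * 1)) t :=
    (((Real.hasDerivAt_cosh t).ofReal_comp.const_mul (-z)).fun_sub
      (Complex.ofRealCLM.hasDerivAt.const_mul m)).cexp
  refine (((hsinh.const_mul z).const_sub m).fun_mul hintegrand).congr_deriv ?_
  have hsq : (Real.cosh t : ℂ) ^ 2 = 1 + (Real.sinh t : ℂ) ^ 2 := by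
    exact_mod_cast Real.cosh_sq' t
  rw [hsq]
  ring

lemma integrable_sub_sinh_mul_macdonaldIntegrand (m : ℂ) {z : ℂ} (hz : 0 < z.re) :
    Integrable fun t : ℝ => (m - z * (Real.sinh t : ℂ)) * macdonaldIntegrand m z t := by
  refine (((integrable_cosh_pow_mul_macdonaldIntegrand m hz 0).norm.const_mul ‖m‖).add
    ((integrable_cosh_pow_mul_macdonaldIntegrand m hz 1).norm.const_mul ‖z‖)).mono' ?_
    (.of_forall fun t => ?_)
  · have := continuous_macdonaldIntegrand m z
    fun_prop
  · simp only [Pi.add_apply, norm_mul, pow_zero, pow_one, one_mul, Complex.norm_real,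
      Real.norm_of_nonneg (Real.cosh_pos t).le]
    rw [← mul_assoc, ← add_mul]
    gcongr
    refine (norm_sub_le _ _).trans ?_
    rw [norm_mul, Complex.norm_real]
    gcongr
    exact abs_sinh_le_cosh t

lemma macdonaldMoment_bessel_equation (m : ℂ) {z : ℂ} (hz : 0 < z.re) :
    z ^ 2 * macdonaldMoment m 2 z - z * macdonaldMoment m 1 z -
      (z ^ 2 + m ^ 2) * macdonaldMoment m 0 z = 0 := by
  have h0 := (integrable_cosh_pow_mul_macdonaldIntegrand m hz 0).const_mul (z ^ 2 + m ^ 2)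
  have h1 := (integrable_cosh_pow_mul_macdonaldIntegrand m hz 1).const_mul z
  have h2 := (integrable_cosh_pow_mul_macdonaldIntegrand m hz 2).const_mul (z ^ 2)
  have h := (integral_sub (h2.sub h1) h0).symm.trans (integral_eq_zero_of_hasDerivAt_of_integrable
    (hasDerivAt_sub_sinh_mul_macdonaldIntegrand m z) ((h2.sub h1).sub h0)
    (integrable_sub_sinh_mul_macdonaldIntegrand m hz))
  rwa [integral_sub' h2 h1, integral_const_mul, integral_const_mul, integral_const_mul] at h

lemma hasDerivAt_cpow_half {z : ℂ} (hz : z ∈ Complex.slitPlane) :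
    HasDerivAt (fun z : ℂ => z ^ (1 / 2 : ℂ)) (z ^ (1 / 2 : ℂ) / (2 * z)) z := by
  have h0 := Complex.slitPlane_ne_zero hz
  refine ((hasDerivAt_id z).cpow_const hz).congr_deriv ?_
  rw [id, Complex.cpow_sub _ _ h0, Complex.cpow_one]
  field_simp

/-- The derivative of `macdonaldIntegral m` on the right half-plane, in terms of moments. -/
def macdonaldIntegralDeriv (m z : ℂ) : ℂ :=
  (√(2 * Real.pi) : ℂ)⁻¹ * (z ^ (1 / 2 : ℂ) / (2 * z) * macdonaldMoment m 0 z +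
    z ^ (1 / 2 : ℂ) * -macdonaldMoment m 1 z)

lemma hasDerivAt_macdonaldIntegral (m : ℂ) {z : ℂ} (hz : 0 < z.re) :
    HasDerivAt (macdonaldIntegral m) (macdonaldIntegralDeriv m z) z := by
  rw [macdonaldIntegral_eq_macdonaldMoment]
  exact ((hasDerivAt_cpow_half (Or.inl hz)).fun_mul (hasDerivAt_macdonaldMoment m 0 hz)).const_mul _

lemma hasDerivAt_macdonaldIntegralDeriv (m : ℂ) {z : ℂ} (hz : 0 < z.re) :
    HasDerivAt (macdonaldIntegralDeriv m)
      ((1 + (m ^ 2 - 1 / 4) / z ^ 2) * macdonaldIntegral m z) z := by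
  have h0 : z ≠ 0 := Complex.slitPlane_ne_zero (Or.inl hz)
  have hroot := hasDerivAt_cpow_half (Or.inl hz)
  refine (((hroot.fun_div ((hasDerivAt_id z).const_mul 2) (mul_ne_zero two_ne_zero h0)).fun_mul
    (hasDerivAt_macdonaldMoment m 0 hz)).fun_add
    (hroot.fun_mul (hasDerivAt_macdonaldMoment m 1 hz).fun_neg)).const_mul
      (√(2 * Real.pi) : ℂ)⁻¹ |>.congr_deriv ?_
  have hbessel : macdonaldMoment m 2 z = (z * macdonaldMoment m 1 z +
      (z ^ 2 + m ^ 2) * macdonaldMoment m 0 z) / z ^ 2 := by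
    rw [eq_div_iff (pow_ne_zero 2 h0)]
    linear_combination macdonaldMoment_bessel_equation m hz
  simp only [macdonaldIntegral_eq_macdonaldMoment, id, Nat.reduceAdd, zero_add, hbessel]
  field_simp
  ring

end MacdonaldIntegral

/-! ### Holomorphic continuation of the Macdonald function -/

section Sector

/-- A sector that contains the closed right half-plane without `0`. -/
def sector : Set ℂ :=
  {z | 0 < z.re + |z.im|}

lemma isOpen_sector : IsOpen sector :=
  isOpen_lt continuous_const (Complex.continuous_re.add Complex.continuous_im.abs)

lemma mem_sector_of_re_pos {z : ℂ} (hz : 0 < z.re) : z ∈ sector :=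
  add_pos_of_pos_of_nonneg hz (abs_nonneg _)

lemma mem_sector_of_re_nonneg {z : ℂ} (hz : 0 ≤ z.re) (h0 : z ≠ 0) : z ∈ sector := by
  rcases hz.eq_or_lt with hre | hre
  · exact add_pos_of_nonneg_of_pos hz (abs_pos.2 fun him => h0 (Complex.ext hre.symm him))
  · exact mem_sector_of_re_pos hre

lemma sector_subset_slitPlane : sector ⊆ Complex.slitPlane := by
  intro z (hz : 0 < z.re + |z.im|)
  by_cases him : z.im = 0
  · rw [him, abs_zero, add_zero] at hz
    exact Or.inl hz
  · exact Or.inr him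

lemma ne_zero_of_mem_sector {z : ℂ} (hz : z ∈ sector) : z ≠ 0 :=
  Complex.slitPlane_ne_zero (sector_subset_slitPlane hz)

lemma starConvex_sector : StarConvex ℝ (1 : ℂ) sector := by
  intro z (hz : 0 < z.re + |z.im|) a b ha hb hab
  simp only [sector, mem_ofPred_eq, Complex.add_re, Complex.smul_re, Complex.one_re,
    Complex.add_im, Complex.smul_im, Complex.one_im, smul_eq_mul, mul_one, mul_zero, zero_add,
    abs_mul, abs_of_nonneg hb]
  rcases ha.eq_or_lt with rfl | ha
  · obtain rfl : b = 1 := by linarith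
    linarith
  · nlinarith [mul_nonneg hb hz.le]

lemma isPreconnected_sector : IsPreconnected sector :=
  (starConvex_sector.isPathConnected
    (mem_sector_of_re_pos zero_lt_one)).isConnected.isPreconnected

lemma re_add_abs_im_sq_div_nonneg {z : ℂ} (hz : z ∈ sector) (v : ℝ) :
    0 ≤ ((v : ℂ) ^ 2 / (4 * z)).re + |((v : ℂ) ^ 2 / (4 * z)).im| := by
  have h : (v : ℂ) ^ 2 / (4 * z) = ((v ^ 2 / 4 : ℝ) : ℂ) * z⁻¹ := by
    push_cast
    ring
  rw [h, Complex.re_ofReal_mul, Complex.im_ofReal_mul, Complex.inv_re, Complex.inv_im, abs_mul,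
    abs_of_nonneg (by positivity : (0 : ℝ) ≤ v ^ 2 / 4), abs_div, abs_neg,
    abs_of_nonneg (Complex.normSq_nonneg z), ← mul_add, ← add_div]
  exact mul_nonneg (by positivity) (div_nonneg (le_of_lt hz) (Complex.normSq_nonneg z))

lemma one_add_mem_sector {ζ : ℂ} (hζ : 0 ≤ ζ.re + |ζ.im|) : 1 + ζ ∈ sector := by
  simp only [sector, mem_ofPred_eq, Complex.add_re, Complex.one_re, Complex.add_im,
    Complex.one_im, zero_add]
  linarith

lemma one_half_le_norm_one_add {ζ : ℂ} (hζ : 0 ≤ ζ.re + |ζ.im|) : 1 / 2 ≤ ‖1 + ζ‖ := by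
  have hre := Complex.re_le_norm (1 + ζ)
  have him := Complex.abs_im_le_norm (1 + ζ)
  rw [Complex.add_re, Complex.one_re] at hre
  rw [Complex.add_im, Complex.one_im, zero_add] at him
  linarith

end Sector

section Gauss

/- For `z > 0` the substitution `v = 2 √z sinh (t / 2)` turns the integral formula into
`exp (-z) / √(2π) ∫ exp (-v² / 2) (w + √(1 + w²))^(-2m) / √(1 + w²) dv` with `w = v / (2 √z)`,
which is holomorphic on a neighbourhood of the closed right half-plane without `0`. -/

/-- The variable `w = v / (2 √z)`. -/
def gaussVar (z : ℂ) (v : ℝ) : ℂ :=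
  (v : ℂ) / (2 * z ^ (1 / 2 : ℂ))

/-- The square root `√(1 + w²)`, where `w = gaussVar z v`. -/
def gaussRoot (z : ℂ) (v : ℝ) : ℂ :=
  (1 + (v : ℂ) ^ 2 / (4 * z)) ^ (1 / 2 : ℂ)

/-- The integrand `exp (-v² / 2) (w + √(1 + w²))^(-2m) / √(1 + w²)`, where `w = gaussVar z v`. -/
def gaussIntegrand (m z : ℂ) (v : ℝ) : ℂ :=
  Complex.exp (-((v : ℂ) ^ 2 / 2)) *
    Complex.exp (-2 * m * Complex.log (gaussVar z v + gaussRoot z v)) / gaussRoot z v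

lemma cpow_half_sq (z : ℂ) : (z ^ (1 / 2 : ℂ)) ^ 2 = z := by
  rw [one_div, Complex.cpow_ofNat_inv_pow]

lemma cpow_half_re_pos {z : ℂ} (hz : z ∈ Complex.slitPlane) : 0 < (z ^ (1 / 2 : ℂ)).re := by
  rw [one_div, Complex.cpow_inv_two_re]
  refine Real.sqrt_pos.2 (half_pos ?_)
  rcases Complex.mem_slitPlane_iff.1 hz with hre | him
  · positivity
  · linarith [neg_abs_le z.re, Complex.abs_re_lt_norm.2 him]

lemma norm_gaussVar (z : ℂ) (v : ℝ) : ‖gaussVar z v‖ = |v| / (2 * √‖z‖) := by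
  have hroot : ‖z ^ (1 / 2 : ℂ)‖ = √‖z‖ := by
    rw [eq_comm, Real.sqrt_eq_iff_eq_sq (norm_nonneg _) (norm_nonneg _), ← norm_pow, cpow_half_sq]
  rw [gaussVar, norm_div, norm_mul, hroot, Complex.norm_real, Real.norm_eq_abs,
    Complex.norm_ofNat]

lemma gaussRoot_sq (z : ℂ) (v : ℝ) : gaussRoot z v ^ 2 = 1 + gaussVar z v ^ 2 := by
  rw [gaussRoot, cpow_half_sq, gaussVar, div_pow, mul_pow, cpow_half_sq]
  norm_num

lemma gaussVar_add_gaussRoot_mul (z : ℂ) (v : ℝ) :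
    (gaussVar z v + gaussRoot z v) * (gaussRoot z v - gaussVar z v) = 1 := by
  linear_combination gaussRoot_sq z v

lemma inv_gaussVar_add_gaussRoot (z : ℂ) (v : ℝ) :
    (gaussVar z v + gaussRoot z v)⁻¹ = gaussRoot z v - gaussVar z v :=
  inv_eq_of_mul_eq_one_right (gaussVar_add_gaussRoot_mul z v)

lemma gaussVar_add_gaussRoot_ne_zero (z : ℂ) (v : ℝ) : gaussVar z v + gaussRoot z v ≠ 0 :=
  left_ne_zero_of_mul_eq_one (gaussVar_add_gaussRoot_mul z v)

lemma norm_gaussRoot_le (z : ℂ) (v : ℝ) : ‖gaussRoot z v‖ ≤ 1 + ‖gaussVar z v‖ := by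
  refine (abs_le_of_sq_le_sq' ?_ (by positivity)).2
  rw [← norm_pow, gaussRoot_sq]
  refine (norm_add_le _ _).trans ?_
  rw [norm_pow, norm_one]
  nlinarith [norm_nonneg (gaussVar z v)]

lemma norm_log_gaussVar_add_gaussRoot_le (z : ℂ) (v : ℝ) :
    ‖Complex.log (gaussVar z v + gaussRoot z v)‖ ≤ 2 * ‖gaussVar z v‖ + Real.pi := by
  have hroot := norm_gaussRoot_le z v
  have hinv := inv_gaussVar_add_gaussRoot z v
  have hpos := norm_pos_iff.2 (gaussVar_add_gaussRoot_ne_zero z v)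
  have hnorm := norm_add_le (gaussVar z v) (gaussRoot z v)
  set σ := gaussVar z v + gaussRoot z v
  have hnorm_inv : ‖σ‖⁻¹ ≤ 1 + 2 * ‖gaussVar z v‖ := by
    rw [← norm_inv, hinv]
    linarith [norm_sub_le (gaussRoot z v) (gaussVar z v)]
  have hlog : Real.log ‖σ‖ ≤ ‖σ‖ - 1 := Real.log_le_sub_one_of_pos hpos
  have hlog_inv : -Real.log ‖σ‖ ≤ ‖σ‖⁻¹ - 1 := by
    rw [← Real.log_inv]
    exact Real.log_le_sub_one_of_pos (inv_pos.2 hpos)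
  refine (Complex.norm_le_abs_re_add_abs_im _).trans (add_le_add ?_ ?_)
  · rw [Complex.log_re, abs_le]
    constructor <;> linarith
  · rw [Complex.log_im]
    exact Complex.abs_arg_le_pi _

variable {z : ℂ}

lemma gaussRoot_re_pos (hz : z ∈ sector) (v : ℝ) : 0 < (gaussRoot z v).re :=
  cpow_half_re_pos
    (sector_subset_slitPlane (one_add_mem_sector (re_add_abs_im_sq_div_nonneg hz v)))

lemma one_half_le_norm_gaussRoot (hz : z ∈ sector) (v : ℝ) : 1 / 2 ≤ ‖gaussRoot z v‖ := by
  have h := one_half_le_norm_one_add (re_add_abs_im_sq_div_nonneg hz v)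
  rw [← cpow_half_sq (1 + (v : ℂ) ^ 2 / (4 * z)), norm_pow, ← gaussRoot] at h
  nlinarith [norm_nonneg (gaussRoot z v)]

/-- `σ + σ⁻¹ = 2 √(1 + w²)` for `σ = w + √(1 + w²)`, and `σ` and `σ⁻¹` have real parts of the
same sign. -/
lemma gaussVar_add_gaussRoot_re_pos (hz : z ∈ sector) (v : ℝ) :
    0 < (gaussVar z v + gaussRoot z v).re := by
  have hroot := gaussRoot_re_pos hz v
  have hinv : (gaussVar z v + gaussRoot z v).re / Complex.normSq (gaussVar z v + gaussRoot z v) =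
      (gaussRoot z v).re - (gaussVar z v).re := by
    rw [← Complex.inv_re, inv_gaussVar_add_gaussRoot, Complex.sub_re]
  by_contra! hneg
  have := div_nonpos_of_nonpos_of_nonneg hneg
    (Complex.normSq_nonneg (gaussVar z v + gaussRoot z v))
  rw [Complex.add_re] at hneg
  linarith

/-- A bound on the integrand that is integrable and uniform away from `0`. -/
def gaussBound (m : ℂ) (d v : ℝ) : ℝ :=
  2 * Real.exp (2 * ‖m‖ * Real.pi) * Real.exp (-(1 / 2) * v ^ 2 + 2 * ‖m‖ / √d * |v|)

lemma integrable_gaussBound (m : ℂ) (d : ℝ) : Integrable (gaussBound m d) :=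
  (integrable_exp_neg_sq_add_abs one_half_pos _).const_mul _

lemma norm_gaussIntegrand_le (m : ℂ) (hz : z ∈ sector) {d : ℝ} (hd : 0 < d) (hdz : d ≤ ‖z‖)
    (v : ℝ) : ‖gaussIntegrand m z v‖ ≤ gaussBound m d v := by
  have hroot := one_half_le_norm_gaussRoot hz v
  have hlog : ‖Complex.log (gaussVar z v + gaussRoot z v)‖ ≤ 2 * (|v| / (2 * √d)) + Real.pi := by
    refine (norm_log_gaussVar_add_gaussRoot_le z v).trans ?_
    rw [norm_gaussVar]
    gcongr
  have hgauss : ‖Complex.exp (-((v : ℂ) ^ 2 / 2))‖ = Real.exp (-(1 / 2) * v ^ 2) := by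
    rw [show -((v : ℂ) ^ 2 / 2) = ((-(1 / 2) * v ^ 2 : ℝ) : ℂ) by push_cast; ring,
      Complex.norm_exp_ofReal]
  have hpow : ‖Complex.exp (-2 * m * Complex.log (gaussVar z v + gaussRoot z v))‖ ≤
      Real.exp (2 * ‖m‖ * (2 * (|v| / (2 * √d)) + Real.pi)) := by
    rw [Complex.norm_exp, Real.exp_le_exp]
    refine (Complex.re_le_norm _).trans ?_
    rw [norm_mul, norm_mul, norm_neg, Complex.norm_ofNat]
    gcongr
  have hexponent : -(1 / 2) * v ^ 2 + 2 * ‖m‖ * (2 * (|v| / (2 * √d)) + Real.pi) =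
      2 * ‖m‖ * Real.pi + (-(1 / 2) * v ^ 2 + 2 * ‖m‖ / √d * |v|) := by ring
  rw [gaussIntegrand, norm_div, norm_mul, hgauss, div_le_iff₀ (by linarith)]
  calc _ ≤ Real.exp (-(1 / 2) * v ^ 2) *
        Real.exp (2 * ‖m‖ * (2 * (|v| / (2 * √d)) + Real.pi)) := by gcongr
    _ = gaussBound m d v * (1 / 2) := by
      rw [gaussBound, ← Real.exp_add, hexponent, Real.exp_add]
      ring
    _ ≤ _ := by
      gcongr
      unfold gaussBound
      positivity

lemma measurable_gaussIntegrand (m z : ℂ) : Measurable (gaussIntegrand m z) := by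
  unfold gaussIntegrand gaussRoot gaussVar
  fun_prop

lemma differentiableOn_gaussIntegrand (m : ℂ) (v : ℝ) :
    DifferentiableOn ℂ (fun z => gaussIntegrand m z v) sector := by
  intro z hz
  have h0 := ne_zero_of_mem_sector hz
  have hroot0 : gaussRoot z v ≠ 0 := fun h => by simpa [h] using gaussRoot_re_pos hz v
  have hhalf0 : z ^ (1 / 2 : ℂ) ≠ 0 := fun h => h0 <| by
    rw [← cpow_half_sq z, h, zero_pow two_ne_zero]
  have hvar : DifferentiableAt ℂ (fun z => gaussVar z v) z :=
    (differentiableAt_const _).fun_div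
      ((hasDerivAt_cpow_half (sector_subset_slitPlane hz)).differentiableAt.const_mul (2 : ℂ))
      (mul_ne_zero two_ne_zero hhalf0)
  have hradicand : DifferentiableAt ℂ (fun z : ℂ => 1 + (v : ℂ) ^ 2 / (4 * z)) z :=
    ((differentiableAt_const _).fun_div (differentiableAt_id.const_mul (4 : ℂ))
      (mul_ne_zero (OfNat.ofNat_ne_zero 4) h0)).const_add 1
  have hroot : DifferentiableAt ℂ (fun z => gaussRoot z v) z :=
    DifferentiableAt.comp z (g := fun y : ℂ => y ^ (1 / 2 : ℂ))
      (hasDerivAt_cpow_half (sector_subset_slitPlane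
        (one_add_mem_sector (re_add_abs_im_sq_div_nonneg hz v)))).differentiableAt hradicand
  have hlog : DifferentiableAt ℂ (fun z => Complex.log (gaussVar z v + gaussRoot z v)) z :=
    (hvar.fun_add hroot).clog (Or.inl (gaussVar_add_gaussRoot_re_pos hz v))
  exact (((hlog.const_mul (-2 * m)).cexp.const_mul _).fun_div hroot hroot0).differentiableWithinAt

end Gauss

section MacdonaldExt

/-- The holomorphic continuation of the Macdonald function to the sector. -/
def macdonaldExt (m z : ℂ) : ℂ :=
  Complex.exp (-z) / (√(2 * Real.pi) : ℂ) * ∫ v : ℝ, gaussIntegrand m z v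

lemma differentiableOn_macdonaldExt (m : ℂ) : DifferentiableOn ℂ (macdonaldExt m) sector := by
  intro z hz
  have hpos : 0 < ‖z‖ := norm_pos_iff.2 (ne_zero_of_mem_sector hz)
  have hint := hasDerivAt_integral_of_holomorphic (μ := volume)
    (isOpen_sector.inter (isOpen_lt continuous_const continuous_norm)) (f := gaussIntegrand m)
    (fun w _ => (measurable_gaussIntegrand m w).aestronglyMeasurable)
    (integrable_gaussBound m (‖z‖ / 2))
    (.of_forall fun v w hw => norm_gaussIntegrand_le m hw.1 (half_pos hpos) (le_of_lt hw.2) v)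
    (.of_forall fun v => (differentiableOn_gaussIntegrand m v).mono inter_subset_left)
    ⟨hz, half_lt_self hpos⟩
  exact ((differentiableAt_id.neg.cexp.div_const _).fun_mul
    hint.differentiableAt).differentiableWithinAt

lemma exists_norm_macdonaldExt_le (m : ℂ) {d : ℝ} (hd : 0 < d) :
    ∃ C : ℝ, ∀ z ∈ sector, d ≤ ‖z‖ → ‖macdonaldExt m z‖ ≤ C * Real.exp (-z.re) := by
  refine ⟨(√(2 * Real.pi))⁻¹ * ∫ v, gaussBound m d v, fun z hz hdz => ?_⟩
  have h := norm_integral_le_of_norm_le (integrable_gaussBound m d)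
    (.of_forall (norm_gaussIntegrand_le m hz hd hdz))
  rw [macdonaldExt, norm_mul, norm_div, Complex.norm_exp, Complex.neg_re, Complex.norm_real,
    Real.norm_of_nonneg (Real.sqrt_nonneg _)]
  calc _ ≤ Real.exp (-z.re) / √(2 * Real.pi) * ∫ v, gaussBound m d v := by gcongr
    _ = _ := by ring

lemma integral_eq_integral_comp_mul_sinh_half {E : Type*} [NormedAddCommGroup E]
    [NormedSpace ℝ E] {c : ℝ} (hc : 0 < c) (f : ℝ → E) :
    ∫ v, f v = ∫ t, (c * Real.cosh (t / 2)) • f (2 * c * Real.sinh (t / 2)) := by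
  have hderiv : ∀ t, HasDerivAt (fun t => 2 * c * Real.sinh (t / 2)) (c * Real.cosh (t / 2)) t :=
    fun t => (((hasDerivAt_id t).div_const 2).sinh.const_mul (2 * c)).congr_deriv (by
      rw [id]
      ring)
  have hbij : Function.Bijective fun t => 2 * c * Real.sinh (t / 2) :=
    ((mulLeft_bijective₀ (2 * c) (by positivity)).comp Real.sinh_bijective).comp
      (mulRight_bijective₀ (2 : ℝ)⁻¹ (by positivity))
  have h := integral_image_eq_integral_abs_deriv_smul MeasurableSet.univ
    (fun t _ => (hderiv t).hasDerivWithinAt) hbij.injective.injOn f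
  rw [image_univ, hbij.surjective.range_eq, setIntegral_univ, setIntegral_univ] at h
  rw [h]
  congr 1
  funext t
  rw [abs_of_pos (mul_pos hc (Real.cosh_pos _))]

lemma ofReal_cpow_half {x : ℝ} (hx : 0 ≤ x) : (x : ℂ) ^ (1 / 2 : ℂ) = (√x : ℂ) := by
  rw [Real.sqrt_eq_rpow, Complex.ofReal_cpow hx]
  norm_num

lemma ofReal_sqrt_sq {x : ℝ} (hx : 0 ≤ x) : (√x : ℂ) ^ 2 = x := by
  exact_mod_cast Real.sq_sqrt hx

lemma gaussVar_sinh {x : ℝ} (hx : 0 < x) (s : ℝ) :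
    gaussVar x (2 * √x * Real.sinh s) = (Real.sinh s : ℂ) := by
  have : (√x : ℂ) ≠ 0 := by exact_mod_cast (Real.sqrt_pos.2 hx).ne'
  rw [gaussVar, ofReal_cpow_half hx.le]
  push_cast
  field_simp

lemma gaussRoot_sinh {x : ℝ} (hx : 0 < x) (s : ℝ) :
    gaussRoot x (2 * √x * Real.sinh s) = (Real.cosh s : ℂ) := by
  have hx0 : (x : ℂ) ≠ 0 := by exact_mod_cast hx.ne'
  have hradicand : 1 + ((2 * √x * Real.sinh s : ℝ) : ℂ) ^ 2 / (4 * x) =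
      ((Real.cosh s ^ 2 : ℝ) : ℂ) := by
    rw [Real.cosh_sq']
    push_cast
    rw [mul_pow, mul_pow, ofReal_sqrt_sq hx.le]
    field_simp
    ring
  rw [gaussRoot, hradicand, ofReal_cpow_half (sq_nonneg _), Real.sqrt_sq (Real.cosh_pos s).le]

lemma gaussIntegrand_sinh_half (m : ℂ) {x : ℝ} (hx : 0 < x) (t : ℝ) :
    Complex.exp (-x) * (√x * Real.cosh (t / 2) * gaussIntegrand m x (2 * √x * Real.sinh (t / 2))) =
      √x * macdonaldIntegrand m x t := by
  have hcosh0 : (Real.cosh (t / 2) : ℂ) ≠ 0 := by exact_mod_cast (Real.cosh_pos (t / 2)).ne'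
  have hlog : Complex.log ((Real.sinh (t / 2) : ℂ) + (Real.cosh (t / 2) : ℂ)) = (t : ℂ) / 2 := by
    rw [← Complex.ofReal_add, Real.sinh_add_cosh, ← Complex.ofReal_log (Real.exp_pos _).le,
      Real.log_exp]
    push_cast
    rfl
  have hcosh : Real.cosh t = 1 + 2 * Real.sinh (t / 2) ^ 2 := by
    have h := Real.cosh_two_mul (t / 2)
    rw [mul_div_cancel₀ t two_ne_zero, Real.cosh_sq'] at h
    linarith
  have hexp : Complex.exp (-x) * (Complex.exp (-(((2 * √x * Real.sinh (t / 2) : ℝ) : ℂ) ^ 2 / 2)) *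
      Complex.exp (-2 * m * ((t : ℂ) / 2))) = macdonaldIntegrand m x t := by
    rw [macdonaldIntegrand, hcosh, ← Complex.exp_add, ← Complex.exp_add]
    push_cast
    rw [mul_pow, mul_pow, ofReal_sqrt_sq hx.le]
    ring_nf
  rw [gaussIntegrand, gaussVar_sinh hx, gaussRoot_sinh hx, hlog, ← hexp]
  field_simp

lemma macdonaldExt_ofReal (m : ℂ) {x : ℝ} (hx : 0 < x) :
    macdonaldExt m x = macdonaldIntegral m x := by
  rw [macdonaldIntegral_eq, macdonaldExt, ofReal_cpow_half hx.le,
    integral_eq_integral_comp_mul_sinh_half (Real.sqrt_pos.2 hx), div_mul_eq_mul_div,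
    div_mul_eq_mul_div, ← integral_const_mul, ← integral_const_mul]
  simp only [Complex.real_smul, Complex.ofReal_mul (√x), gaussIntegrand_sinh_half m hx]

lemma isOpen_re_pos : IsOpen {z : ℂ | 0 < z.re} :=
  isOpen_lt continuous_const Complex.continuous_re

lemma frequently_eq_of_forall_ofReal_eq {f g : ℂ → ℂ} (h : ∀ x : ℝ, 0 < x → f x = g x) :
    ∃ᶠ z in 𝓝[≠] (1 : ℂ), f z = g z := by
  have hlim : Tendsto ((↑) : ℝ → ℂ) (𝓝[≠] 1) (𝓝[≠] ((1 : ℝ) : ℂ)) :=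
    Complex.continuous_ofReal.continuousAt.continuousWithinAt.tendsto_nhdsWithin
      fun y hy => Complex.ofReal_injective.ne hy
  refine (Complex.ofReal_one ▸ hlim).frequently (Eventually.frequently ?_)
  filter_upwards [nhdsWithin_le_nhds (Ioi_mem_nhds zero_lt_one)] with y hy using h y hy

lemma macdonaldExt_eq_macdonaldIntegral (m : ℂ) {z : ℂ} (hz : 0 < z.re) :
    macdonaldExt m z = macdonaldIntegral m z := by
  have hext : AnalyticOnNhd ℂ (macdonaldExt m) {z : ℂ | 0 < z.re} :=
    ((differentiableOn_macdonaldExt m).mono fun z hz => mem_sector_of_re_pos hz).analyticOnNhd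
      isOpen_re_pos
  have hint : AnalyticOnNhd ℂ (macdonaldIntegral m) {z : ℂ | 0 < z.re} :=
    DifferentiableOn.analyticOnNhd (fun z hz =>
      (hasDerivAt_macdonaldIntegral m hz).differentiableAt.differentiableWithinAt) isOpen_re_pos
  exact hext.eqOn_of_preconnected_of_frequently_eq hint
    (convex_halfSpace_re_gt 0).isPreconnected (zero_lt_one (α := ℝ))
    (frequently_eq_of_forall_ofReal_eq fun x hx => macdonaldExt_ofReal m hx) hz

lemma deriv_deriv_macdonaldExt_of_re_pos (m : ℂ) {z : ℂ} (hz : 0 < z.re) :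
    deriv (deriv (macdonaldExt m)) z = (1 + (m ^ 2 - 1 / 4) / z ^ 2) * macdonaldExt m z := by
  have heq : ∀ z : ℂ, 0 < z.re → macdonaldExt m =ᶠ[𝓝 z] macdonaldIntegral m := fun z hz =>
    (isOpen_re_pos.eventually_mem hz).mono fun w hw => macdonaldExt_eq_macdonaldIntegral m hw
  have hderiv : deriv (macdonaldExt m) =ᶠ[𝓝 z] macdonaldIntegralDeriv m := by
    filter_upwards [isOpen_re_pos.eventually_mem hz] with w hw
    rw [(heq w hw).deriv_eq, (hasDerivAt_macdonaldIntegral m hw).deriv]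
  rw [hderiv.deriv_eq, (hasDerivAt_macdonaldIntegralDeriv m hz).deriv,
    macdonaldExt_eq_macdonaldIntegral m hz]

lemma hasDerivAt_deriv_macdonaldExt (m : ℂ) {z : ℂ} (hz : z ∈ sector) :
    HasDerivAt (deriv (macdonaldExt m))
      ((1 + (m ^ 2 - 1 / 4) / z ^ 2) * macdonaldExt m z) z := by
  have hext := differentiableOn_macdonaldExt m
  have hderiv := hext.deriv isOpen_sector
  have hrhs : DifferentiableOn ℂ (fun z => (1 + (m ^ 2 - 1 / 4) / z ^ 2) * macdonaldExt m z)
      sector :=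
    ((((differentiableOn_const _).fun_div (differentiableOn_pow 2) fun z hz =>
      pow_ne_zero 2 (ne_zero_of_mem_sector hz))).const_add 1).fun_mul hext
  have hode := ((hderiv.deriv isOpen_sector).analyticOnNhd
    isOpen_sector).eqOn_of_preconnected_of_eventuallyEq (hrhs.analyticOnNhd isOpen_sector)
    isPreconnected_sector (mem_sector_of_re_pos (zero_lt_one (α := ℝ)))
    ((isOpen_re_pos.eventually_mem (x := 1) (zero_lt_one (α := ℝ))).mono fun w hw =>
      deriv_deriv_macdonaldExt_of_re_pos m hw)
  exact (hderiv.differentiableAt (isOpen_sector.mem_nhds hz)).hasDerivAt.congr_deriv (hode hz)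

end MacdonaldExt

/-! ### The unperturbed Jost solution -/

section FreeJost

lemma macdonald_eq_macdonaldExt (m : ℂ) {z : ℂ} (hz : 0 ≤ z.re) (h0 : z ≠ 0) :
    macdonald m z = macdonaldExt m z := by
  refine extendFrom_eq (by rwa [Complex.closure_setOfPred_lt_re]) ?_
  have hcont : ContinuousAt (macdonaldExt m) z :=
    ((differentiableOn_macdonaldExt m).differentiableAt
      (isOpen_sector.mem_nhds (mem_sector_of_re_nonneg hz h0))).continuousAt
  refine (hcont.tendsto.mono_left nhdsWithin_le_nhds).congr' ?_
  filter_upwards [self_mem_nhdsWithin] with w hw using macdonaldExt_eq_macdonaldIntegral m hw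

variable {k : ℂ}

lemma mul_ofReal_mem_sector (hk : 0 ≤ k.re) (hk0 : k ≠ 0) {x : ℝ} (hx : 0 < x) :
    k * x ∈ sector := by
  refine mem_sector_of_re_nonneg ?_ (mul_ne_zero hk0 (by exact_mod_cast hx.ne'))
  rw [Complex.re_mul_ofReal]
  positivity

lemma freeJost_eq_macdonaldExt (m : ℂ) (hk : 0 ≤ k.re) (hk0 : k ≠ 0) {x : ℝ} (hx : 0 < x) :
    freeJost m k x = macdonaldExt m (k * x) := by
  refine macdonald_eq_macdonaldExt m ?_ (mul_ne_zero hk0 (by exact_mod_cast hx.ne'))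
  rw [Complex.re_mul_ofReal]
  positivity

lemma isClassical_freeJost (m : ℂ) (hk : 0 ≤ k.re) (hk0 : k ≠ 0) :
    IsClassical (besselCoeff m k) (freeJost m k) := by
  have hmul : ∀ x : ℝ, HasDerivAt (fun x : ℝ => k * (x : ℂ)) k x := fun x =>
    (Complex.ofRealCLM.hasDerivAt.const_mul k).congr_deriv (by simp)
  refine IsClassical.of_hasDerivAt (f' := fun x => deriv (macdonaldExt m) (k * x) * k)
    (fun x hx => ?_) fun x hx => ?_
  · have hext := ((differentiableOn_macdonaldExt m).differentiableAt
      (isOpen_sector.mem_nhds (mul_ofReal_mem_sector hk hk0 hx))).hasDerivAt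
    refine (hext.comp x (hmul x)).congr_of_eventuallyEq ?_
    filter_upwards [Ioi_mem_nhds hx] with y hy using freeJost_eq_macdonaldExt m hk hk0 hy
  · have hderiv := hasDerivAt_deriv_macdonaldExt m (mul_ofReal_mem_sector hk hk0 hx)
    refine ((hderiv.comp x (hmul x)).mul_const k).congr_deriv ?_
    rw [freeJost_eq_macdonaldExt m hk hk0 hx, besselCoeff]
    have hx0 : (x : ℂ) ≠ 0 := by exact_mod_cast hx.ne'
    field_simp

lemma exists_norm_freeJost_le (m : ℂ) (hk : 0 ≤ k.re) (hk0 : k ≠ 0) {a : ℝ} (ha : 0 < a) :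
    ∃ C : ℝ, ∀ x, a < x → ‖freeJost m k x‖ ≤ C * expWeight k x := by
  obtain ⟨C, hC⟩ := exists_norm_macdonaldExt_le m (mul_pos (norm_pos_iff.2 hk0) ha)
  refine ⟨C, fun x hx => ?_⟩
  have hx0 : 0 < x := ha.trans hx
  rw [freeJost_eq_macdonaldExt m hk hk0 hx0]
  refine (hC _ (mul_ofReal_mem_sector hk hk0 hx0) ?_).trans_eq ?_
  · rw [norm_mul, Complex.norm_real, Real.norm_of_nonneg hx0.le]
    gcongr
  · rw [expWeight, Complex.re_mul_ofReal, mul_comm k.re, neg_mul]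

end FreeJost

/-! ### The backward Green's operator -/

section IntegralIoi

variable {E : Type*} [NormedAddCommGroup E] [NormedSpace ℝ E] {f : ℝ → E}

lemma integral_Ioi_eq_sub (hf : ∀ a, 0 < a → IntegrableOn f (Ioi a)) {c x : ℝ} (hc : 0 < c)
    (hx : 0 < x) : ∫ t in Ioi x, f t = (∫ t in Ioi c, f t) - ∫ t in c..x, f t := by
  rw [← intervalIntegral.integral_Ioi_sub_Ioi' (hf c hc) (hf x hx), sub_sub_cancel]

lemma locallyAC_integral_Ioi (hf : ∀ a, 0 < a → IntegrableOn f (Ioi a)) :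
    LocallyAC fun x => ∫ t in Ioi x, f t := by
  intro a b ha hab
  have hint : IntervalIntegrable f volume a b :=
    (intervalIntegrable_iff_integrableOn_Ioc_of_le hab).2 ((hf a ha).mono_set Ioc_subset_Ioi_self)
  refine absolutelyContinuousOnInterval_of_dist_le
    (absolutelyContinuousOnInterval_integral hint) fun x hx y hy => ?_
  have hsub := uIcc_subset_Ioi_zero ha (ha.trans_le hab)
  rw [integral_Ioi_eq_sub hf ha (hsub hx), integral_Ioi_eq_sub hf ha (hsub hy), dist_sub_left]

lemma ae_hasDerivAt_integral_Ioi [CompleteSpace E] (hf : ∀ a, 0 < a → IntegrableOn f (Ioi a)) :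
    ∀ᵐ x ∂(volume.restrict (Ioi (0 : ℝ))), HasDerivAt (fun x => ∫ t in Ioi x, f t) (-f x) x := by
  refine ae_restrict_Ioi_zero fun a b ha hab => ?_
  have hint : IntervalIntegrable f volume a b :=
    (intervalIntegrable_iff_integrableOn_Ioc_of_le hab).2 ((hf a ha).mono_set Ioc_subset_Ioi_self)
  filter_upwards [hint.ae_hasDerivAt_integral] with x hx hxab
  rw [uIcc_of_le hab] at hx
  refine ((hx hxab a (left_mem_Icc.2 hab)).const_sub
    (∫ t in Ioi a, f t)).congr_of_eventuallyEq ?_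
  filter_upwards [Ioi_mem_nhds (ha.trans_le hxab.1)] with y hy using integral_Ioi_eq_sub hf ha hy

end IntegralIoi

section Weight

variable {k : ℂ} {a : ℝ}

lemma expWeight_pos (k : ℂ) (x : ℝ) : 0 < expWeight k x :=
  Real.exp_pos _

lemma continuous_expWeight (k : ℂ) : Continuous (expWeight k) := by
  unfold expWeight
  fun_prop

lemma isWeight_expWeight (a : ℝ) (k : ℂ) : IsWeight a (expWeight k) :=
  isWeight_of_continuousOn (continuous_expWeight k).continuousOn fun x _ => expWeight_pos k x

lemma exp_sub_mul_expWeight (k : ℂ) (x y : ℝ) :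
    Real.exp ((y - x) * k.re) * expWeight k y = expWeight k x := by
  rw [expWeight, expWeight, ← Real.exp_add]
  congr 1
  ring

lemma norm_div_expWeight (k z : ℂ) (x : ℝ) : ‖z / (expWeight k x : ℂ)‖ = ‖z‖ / expWeight k x := by
  rw [norm_div, Complex.norm_real, Real.norm_of_nonneg (expWeight_pos k x).le]

lemma IsClassical.aestronglyMeasurable {V h : ℝ → ℂ} (hh : IsClassical V h) (ha : 0 < a) :
    AEStronglyMeasurable h (volume.restrict (Ioi a)) :=
  (hh.continuousOn.mono (Ioi_subset_Ioi ha.le)).aestronglyMeasurable measurableSet_Ioi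

lemma memWeighted_freeJost (m : ℂ) (hk : 0 ≤ k.re) (hk0 : k ≠ 0) (ha : 0 < a) :
    MemWeighted a (expWeight k) (freeJost m k) := by
  obtain ⟨C, hC⟩ := exists_norm_freeJost_le m hk hk0 ha
  exact memWeighted_of_ae_norm_le (isWeight_expWeight a k)
    ((isClassical_freeJost m hk hk0).aestronglyMeasurable ha)
    ((ae_restrict_mem measurableSet_Ioi).mono hC)

end Weight

section BackwardGreen

variable {Q : ℝ → ℂ} {m k : ℂ} {a : ℝ}

lemma backwardGreen_of_le {x y : ℝ} (h : y ≤ x) : backwardGreen m k x y = 0 := by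
  rcases h.eq_or_lt with rfl | h
  · rw [backwardGreen, if_pos le_rfl, canonicalBisolution_self, neg_zero]
  · exact if_neg h.not_ge

lemma backwardGreen_of_lt {x y : ℝ} (h : x < y) :
    backwardGreen m k x y = -canonicalBisolution m k x y :=
  if_pos h.le

lemma aestronglyMeasurable_backwardGreen_right (m k : ℂ) (ha : 0 < a) (x : ℝ) :
    AEStronglyMeasurable (backwardGreen m k x) (volume.restrict (Ioi a)) :=
  ((isClassical_fundamentalPair_combination m k _ _).aestronglyMeasurable ha).neg.indicator
    (measurableSet_Ici (a := x))

lemma aestronglyMeasurable_backwardGreen (m k : ℂ) (ha : 0 < a) :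
    AEStronglyMeasurable (fun p : ℝ × ℝ => backwardGreen m k p.1 p.2)
      ((volume.restrict (Ioi a)).prod (volume.restrict (Ioi a))) := by
  have h₁ := (isClassical_fundamentalPair_fst m k).aestronglyMeasurable ha
  have h₂ := (isClassical_fundamentalPair_snd m k).aestronglyMeasurable ha
  have hbisolution : AEStronglyMeasurable (fun p : ℝ × ℝ => canonicalBisolution m k p.1 p.2)
      ((volume.restrict (Ioi a)).prod (volume.restrict (Ioi a))) :=
    ((h₁.comp_fst.mul h₂.comp_snd).sub (h₂.comp_fst.mul h₁.comp_snd)).mul_const _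
  exact hbisolution.neg.indicator (measurableSet_le measurable_fst measurable_snd)

theorem oneAddInvertible_backwardGreenMul (m : ℂ) (hk : 0 ≤ k.re) (hk0 : k ≠ 0) (ha : 0 < a)
    (hQ : IntegrableOn Q (Ioi a)) :
    OneAddInvertible a (expWeight k) (backwardGreenMul Q m k) := by
  obtain ⟨C, hC⟩ := exists_bisolution_bound m hk hk0 ha
  refine oneAddInvertible_of_backward_volterra (q := fun y => C * ‖Q y‖) (isWeight_expWeight a k)
    ((aestronglyMeasurable_backwardGreen m k ha).mul hQ.1.comp_snd)
    (fun x _ => (aestronglyMeasurable_backwardGreen_right m k ha x).mul hQ.1)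
    (fun x _ y hyx => by rw [backwardGreenMul, backwardGreen_of_le hyx, zero_mul])
    (fun x hx y hxy => ?_) (hQ.norm.const_mul C)
  rw [backwardGreenMul, backwardGreen_of_lt hxy, norm_mul, norm_neg]
  have hw := (expWeight_pos k y).le
  calc ‖canonicalBisolution m k x y‖ * ‖Q y‖ * expWeight k y
      ≤ C * Real.exp ((y - x) * k.re) * ‖Q y‖ * expWeight k y := by
        gcongr
        exact (hC x y hx.le hxy.le).1
    _ = Real.exp ((y - x) * k.re) * expWeight k y * (C * ‖Q y‖) := by ring
    _ = _ := by rw [exp_sub_mul_expWeight]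

/-- The function `-G g`, where `G` is the backward Green's operator. -/
def greenIntegral (m k : ℂ) (g : ℝ → ℂ) (x : ℝ) : ℂ :=
  ∫ y in Ioi x, canonicalBisolution m k x y * g y

lemma kernelOp_backwardGreenMul {x : ℝ} (hax : a ≤ x) (f : ℝ → ℂ) :
    kernelOp a (backwardGreenMul Q m k) f x = -greenIntegral m k (fun y => Q y * f y) x := by
  have hker : ∀ y, backwardGreenMul Q m k x y * f y = (Ioi x).indicator
      (fun y => -(canonicalBisolution m k x y * (Q y * f y))) y := fun y => by
    rcases lt_or_ge x y with hxy | hyx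
    · rw [indicator_of_mem (mem_Ioi.2 hxy), backwardGreenMul, backwardGreen_of_lt hxy]
      ring
    · rw [indicator_of_notMem (notMem_Ioi.2 hyx), backwardGreenMul, backwardGreen_of_le hyx,
        zero_mul, zero_mul]
  rw [kernelOp, integral_congr_ae (.of_forall hker), setIntegral_indicator measurableSet_Ioi,
    inter_eq_self_of_subset_right (Ioi_subset_Ioi hax), integral_neg, greenIntegral]

end BackwardGreen

/-! ### The inhomogeneous equation -/

section VariationOfConstants

/-- `f`, with derivative `f'`, is a solution of class `AC¹` of the inhomogeneous equation
`f'' = V f + g` on `]0,∞[`. -/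
structure SolvesInhomogeneous (V g f f' : ℝ → ℂ) : Prop where
  hasDerivAt : ∀ x, 0 < x → HasDerivAt f (f' x) x
  locallyAC : LocallyAC f'
  ae_hasDerivAt : ∀ᵐ x ∂(volume.restrict (Ioi (0 : ℝ))), HasDerivAt f' (V x * f x + g x) x

variable {V g : ℝ → ℂ}

lemma IsClassical.locallyAC {h : ℝ → ℂ} (hh : IsClassical V h) : LocallyAC h :=
  .of_hasDerivAt (fun x hx => (hh x hx).1) hh.continuousOn_deriv

lemma IsClassical.locallyAC_deriv {h : ℝ → ℂ} (hh : IsClassical V h)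
    (hV : ContinuousOn V (Ioi 0)) : LocallyAC (deriv h) :=
  .of_hasDerivAt (fun x hx => (hh x hx).2) (hV.mul hh.continuousOn)

lemma SolvesInhomogeneous.add_isClassical {f f' h : ℝ → ℂ} (hf : SolvesInhomogeneous V g f f')
    (hV : ContinuousOn V (Ioi 0)) (hh : IsClassical V h) :
    SolvesInhomogeneous V g (fun x => h x + f x) fun x => deriv h x + f' x where
  hasDerivAt x hx := (hh x hx).1.fun_add (hf.hasDerivAt x hx)
  locallyAC := (hh.locallyAC_deriv hV).add hf.locallyAC
  ae_hasDerivAt := by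
    filter_upwards [hf.ae_hasDerivAt, ae_restrict_mem measurableSet_Ioi] with x hfx hx
    exact ((hh x hx).2.fun_add hfx).congr_deriv (by ring)

lemma SolvesInhomogeneous.congr {f₁ f₁' f₂ f₂' : ℝ → ℂ} (h : SolvesInhomogeneous V g f₁ f₁')
    (hf : EqOn f₁ f₂ (Ioi 0)) (hf' : EqOn f₁' f₂' (Ioi 0)) : SolvesInhomogeneous V g f₂ f₂' where
  hasDerivAt x hx := hf' hx ▸ (h.hasDerivAt x hx).congr_of_eventuallyEq
    (hf.eventuallyEq_of_mem (Ioi_mem_nhds hx)).symm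
  locallyAC := h.locallyAC.congr hf'
  ae_hasDerivAt := by
    filter_upwards [h.ae_hasDerivAt, ae_restrict_mem measurableSet_Ioi] with x hfx hx
    exact hf hx ▸ hfx.congr_of_eventuallyEq (hf'.eventuallyEq_of_mem (Ioi_mem_nhds hx)).symm

lemma SolvesInhomogeneous.isClassical_sub {f₁ f₁' f₂ f₂' : ℝ → ℂ}
    (hf₁ : SolvesInhomogeneous V g f₁ f₁') (hf₂ : SolvesInhomogeneous V g f₂ f₂')
    (hV : ContinuousOn V (Ioi 0)) : IsClassical V fun x => f₁ x - f₂ x := by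
  have hderiv : ∀ x, 0 < x → HasDerivAt (fun x => f₁ x - f₂ x) (f₁' x - f₂' x) x := fun x hx =>
    (hf₁.hasDerivAt x hx).fun_sub (hf₂.hasDerivAt x hx)
  have hcont : ContinuousOn (fun x => V x * (f₁ x - f₂ x)) (Ioi 0) :=
    hV.mul fun x hx => (hderiv x hx).continuousAt.continuousWithinAt
  refine .of_hasDerivAt hderiv fun x hx =>
    (hf₁.locallyAC.sub hf₂.locallyAC).hasDerivAt_of_ae hcont ?_ hx
  filter_upwards [hf₁.ae_hasDerivAt, hf₂.ae_hasDerivAt] with x h₁ h₂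
  exact (h₁.fun_sub h₂).congr_deriv (by ring)

theorem solvesInhomogeneous_of_variation_of_constants {h₁ h₂ c₁ c₂ c₁' c₂' : ℝ → ℂ}
    (hV : ContinuousOn V (Ioi 0)) (hh₁ : IsClassical V h₁) (hh₂ : IsClassical V h₂)
    (hc₁ : LocallyAC c₁) (hc₂ : LocallyAC c₂)
    (hc₁' : ∀ᵐ x ∂(volume.restrict (Ioi (0 : ℝ))), HasDerivAt c₁ (c₁' x) x)
    (hc₂' : ∀ᵐ x ∂(volume.restrict (Ioi (0 : ℝ))), HasDerivAt c₂ (c₂' x) x)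
    (hzero : ∀ x, 0 < x → h₁ x * c₁' x + h₂ x * c₂' x = 0)
    (hsource : ∀ x, 0 < x → deriv h₁ x * c₁' x + deriv h₂ x * c₂' x = g x) :
    SolvesInhomogeneous V g (fun x => h₁ x * c₁ x + h₂ x * c₂ x)
      fun x => deriv h₁ x * c₁ x + deriv h₂ x * c₂ x := by
  have hAC := ((hh₁.locallyAC_deriv hV).mul hc₁).add ((hh₂.locallyAC_deriv hV).mul hc₂)
  refine ⟨fun x hx => ((hh₁.locallyAC.mul hc₁).add (hh₂.locallyAC.mul hc₂)).hasDerivAt_of_ae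
    hAC.continuousOn ?_ hx, hAC, ?_⟩
  all_goals filter_upwards [hc₁', hc₂', ae_restrict_mem measurableSet_Ioi] with x h₁' h₂' hx
  · refine (((hh₁ x hx).1.fun_mul h₁').fun_add ((hh₂ x hx).1.fun_mul h₂')).congr_deriv ?_
    linear_combination hzero x hx
  · refine (((hh₁ x hx).2.fun_mul h₁').fun_add ((hh₂ x hx).2.fun_mul h₂')).congr_deriv ?_
    linear_combination hsource x hx

end VariationOfConstants

section GreenIntegral

variable {m k : ℂ} {g h : ℝ → ℂ}

/-- The derivative of `greenIntegral m k g`. -/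
def greenIntegralDeriv (m k : ℂ) (g : ℝ → ℂ) (x : ℝ) : ℂ :=
  ∫ y in Ioi x, canonicalBisolutionDeriv m k x y * g y

lemma IsClassical.exists_norm_mul_expWeight_le (hh : IsClassical (besselCoeff m k) h)
    (hk : 0 ≤ k.re) (hk0 : k ≠ 0) {a : ℝ} (ha : 0 < a) :
    ∃ C, ∀ y, a ≤ y → ‖h y‖ * expWeight k y ≤ C ∧ ‖deriv h y‖ * expWeight k y ≤ C := by
  obtain ⟨C, hC⟩ := exists_growth_bound (continuousOn_besselCoeff m k) hk hk0 ha
    (integrableOn_besselCoeff_sub m k ha)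
  refine ⟨C * expWeight k a * (‖h a‖ + ‖deriv h a‖), fun y hy => ?_⟩
  rw [← exp_sub_mul_expWeight k a y, ← mul_assoc, mul_right_comm]
  have hpos := (expWeight_pos k y).le
  exact (hC h hh a y le_rfl hy).imp (mul_le_mul_of_nonneg_right · hpos)
    (mul_le_mul_of_nonneg_right · hpos)

lemma IsClassical.integrableOn_mul (hh : IsClassical (besselCoeff m k) h)
    (hk : 0 ≤ k.re) (hk0 : k ≠ 0) {a : ℝ} (ha : 0 < a)
    (hg : IntegrableOn (fun y => g y / (expWeight k y : ℂ)) (Ioi a)) :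
    IntegrableOn (fun y => h y * g y) (Ioi a) := by
  obtain ⟨C, hC⟩ := hh.exists_norm_mul_expWeight_le hk hk0 ha
  have hbdd : ∀ᵐ y ∂(volume.restrict (Ioi a)), ‖h y * (expWeight k y : ℂ)‖ ≤ C := by
    filter_upwards [ae_restrict_mem measurableSet_Ioi] with y hy
    rw [norm_mul, Complex.norm_real, Real.norm_of_nonneg (expWeight_pos k y).le]
    exact (hC y (le_of_lt hy)).1
  refine (Integrable.bdd_mul hg ((hh.aestronglyMeasurable ha).mul
    (isWeight_expWeight a k).aestronglyMeasurable_ofReal) hbdd).congr (.of_forall fun y => ?_)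
  have := Complex.ofReal_ne_zero.2 (expWeight_pos k y).ne'
  simp only [Pi.mul_apply]
  field_simp

lemma integral_kernel_isLittleO_expWeight {B : ℝ → ℝ → ℂ} {a C : ℝ}
    (hB : ∀ x y, a ≤ x → x ≤ y → ‖B x y‖ ≤ C * Real.exp ((y - x) * k.re))
    (hg : IntegrableOn (fun y => g y / (expWeight k y : ℂ)) (Ioi a)) :
    (fun x => ∫ y in Ioi x, B x y * g y) =o[atTop] expWeight k := by
  have hle : ∀ x, a ≤ x → ‖∫ y in Ioi x, B x y * g y‖ ≤
      C * (∫ y in Ioi x, ‖g y / (expWeight k y : ℂ)‖) * expWeight k x := fun x hx => by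
    rw [← integral_const_mul, ← integral_mul_const]
    refine norm_integral_le_of_norm_le
      (((IntegrableOn.mono_set hg (Ioi_subset_Ioi hx)).norm.const_mul C).mul_const _) ?_
    filter_upwards [ae_restrict_mem measurableSet_Ioi] with y hy
    have hpos := (expWeight_pos k y).ne'
    calc ‖B x y * g y‖ ≤ C * Real.exp ((y - x) * k.re) * ‖g y‖ := by
          rw [norm_mul]
          gcongr
          exact hB x y hx (le_of_lt hy)
      _ = _ := by
          rw [norm_div_expWeight, ← exp_sub_mul_expWeight k x y]
          field_simp
  have htail : Tendsto (fun x => C * ∫ y in Ioi x, ‖g y / (expWeight k y : ℂ)‖) atTop (𝓝 0) := by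
    simpa only [id, mul_zero] using (tendsto_integral_Ioi_zero tendsto_id).const_mul C
  refine IsBigO.trans_isLittleO (.of_norm_eventuallyLE (eventually_atTop.2 ⟨a, hle⟩)) ?_
  simpa only [one_mul] using
    ((isLittleO_one_iff ℝ).2 htail).mul_isBigO (isBigO_refl (expWeight k) atTop)

lemma greenIntegral_isLittleO (m : ℂ) (hk : 0 ≤ k.re) (hk0 : k ≠ 0) {a : ℝ} (ha : 0 < a)
    (hg : IntegrableOn (fun y => g y / (expWeight k y : ℂ)) (Ioi a)) :
    greenIntegral m k g =o[atTop] expWeight k ∧ greenIntegralDeriv m k g =o[atTop] expWeight k := by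
  obtain ⟨C, hC⟩ := exists_bisolution_bound m hk hk0 ha
  exact ⟨integral_kernel_isLittleO_expWeight (fun x y hx hxy => (hC x y hx hxy).1) hg,
    integral_kernel_isLittleO_expWeight (fun x y hx hxy => (hC x y hx hxy).2) hg⟩

lemma integral_fundamentalPair_combination_mul (m : ℂ) (hk : 0 ≤ k.re) (hk0 : k ≠ 0) {a : ℝ}
    (ha : 0 < a) (hg : IntegrableOn (fun y => g y / (expWeight k y : ℂ)) (Ioi a)) (α β : ℂ) :
    ∫ y in Ioi a, (α * (fundamentalPair m k).2 y - β * (fundamentalPair m k).1 y) /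
        wronskian (fundamentalPair m k).1 (fundamentalPair m k).2 1 * g y =
      α * (∫ y in Ioi a, (fundamentalPair m k).2 y * g y /
          wronskian (fundamentalPair m k).1 (fundamentalPair m k).2 1) +
        β * ∫ y in Ioi a, -((fundamentalPair m k).1 y * g y) /
          wronskian (fundamentalPair m k).1 (fundamentalPair m k).2 1 := by
  have hint₁ := (isClassical_fundamentalPair_fst m k).integrableOn_mul hk hk0 ha hg
  have hint₂ := (isClassical_fundamentalPair_snd m k).integrableOn_mul hk hk0 ha hg
  rw [← integral_const_mul, ← integral_const_mul,
    ← integral_add ((hint₂.div_const _).const_mul α) ((hint₁.fun_neg.div_const _).const_mul β)]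
  congr with y
  ring

theorem solvesInhomogeneous_greenIntegral (m : ℂ) (hk : 0 ≤ k.re) (hk0 : k ≠ 0)
    (hg : ∀ a, 0 < a → IntegrableOn (fun y => g y / (expWeight k y : ℂ)) (Ioi a)) :
    SolvesInhomogeneous (besselCoeff m k) g (greenIntegral m k g) (greenIntegralDeriv m k g) := by
  have hh₁ := isClassical_fundamentalPair_fst m k
  have hh₂ := isClassical_fundamentalPair_snd m k
  have hW0 := wronskian_fundamentalPair_ne_zero m k
  have hsplit := fun α β x (hx : 0 < x) =>
    (integral_fundamentalPair_combination_mul m hk hk0 hx (hg x hx) α β).symm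
  set h₁ := (fundamentalPair m k).1
  set h₂ := (fundamentalPair m k).2
  set W := wronskian h₁ h₂ 1
  have hint₁ : ∀ a, 0 < a → IntegrableOn (fun y => -(h₁ y * g y) / W) (Ioi a) := fun a ha =>
    (hh₁.integrableOn_mul hk hk0 ha (hg a ha)).neg.div_const W
  have hint₂ : ∀ a, 0 < a → IntegrableOn (fun y => h₂ y * g y / W) (Ioi a) := fun a ha =>
    (hh₂.integrableOn_mul hk hk0 ha (hg a ha)).div_const W
  refine (solvesInhomogeneous_of_variation_of_constants (continuousOn_besselCoeff m k) hh₁ hh₂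
    (locallyAC_integral_Ioi hint₂) (locallyAC_integral_Ioi hint₁)
    (ae_hasDerivAt_integral_Ioi hint₂) (ae_hasDerivAt_integral_Ioi hint₁)
    (fun x _ => by ring) fun x hx => ?_).congr (fun x hx => hsplit _ _ x hx)
    fun x hx => hsplit _ _ x hx
  have hWx : h₁ x * deriv h₂ x - deriv h₁ x * h₂ x = W := wronskian_fundamentalPair m k hx
  field_simp
  linear_combination g x * hWx

end GreenIntegral

/-! ### The perturbed equation -/

section IntegralEquation

variable {Q f w v : ℝ → ℂ} {m k : ℂ} {a : ℝ}

lemma integrableOn_Ioi_of_pos {f : ℝ → ℂ} (hloc : LocallyIntegrableOn f (Ioi 0)) {b : ℝ}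
    (hf : IntegrableOn f (Ioi b)) (ha : 0 < a) : IntegrableOn f (Ioi a) := by
  have hIcc := hloc.integrableOn_compact_subset
    (fun x (hx : x ∈ Icc a b) => ha.trans_le hx.1) isCompact_Icc
  refine (hIcc.union hf).mono_set fun x hx => ?_
  exact (le_or_gt x b).imp (fun hxb => ⟨le_of_lt hx, hxb⟩) id

lemma MemWeighted.integrableOn_mul_div {φ : ℝ → ℝ} (hw : MemWeighted a φ w)
    (hQ : IntegrableOn Q (Ioi a)) : IntegrableOn (fun y => Q y * w y / (φ y : ℂ)) (Ioi a) :=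
  (Integrable.mul_of_top_left hQ hw.memLp).congr
    (.of_forall fun y => (mul_div_assoc (Q y) (w y) (φ y : ℂ)).symm)

lemma memWeighted_of_isBigO (hf : ContinuousOn f (Ioi 0)) (hO : f =O[atTop] expWeight k)
    (ha : 0 < a) : MemWeighted a (expWeight k) f := by
  obtain ⟨C, hC⟩ := hO.bound
  obtain ⟨R, hR⟩ := eventually_atTop.1 hC
  have hcont : ContinuousOn (fun x => ‖f x‖ / expWeight k x) (Icc a R) :=
    (hf.norm.div (continuous_expWeight k).continuousOn fun x _ => (expWeight_pos k x).ne').mono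
      fun x hx => ha.trans_le hx.1
  obtain ⟨M, hM⟩ := isCompact_Icc.exists_bound_of_continuousOn hcont
  refine memWeighted_of_ae_norm_le (M := max M C) (isWeight_expWeight a k)
    ((hf.mono (Ioi_subset_Ioi ha.le)).aestronglyMeasurable measurableSet_Ioi) ?_
  filter_upwards [ae_restrict_mem measurableSet_Ioi] with x hx
  have hpos := expWeight_pos k x
  rcases le_total x R with hxR | hxR
  · have hMx := (le_abs_self _).trans (hM x ⟨le_of_lt hx, hxR⟩)
    exact ((div_le_iff₀ hpos).1 hMx).trans (mul_le_mul_of_nonneg_right (le_max_left _ _) hpos.le)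
  · have hCx := hR x hxR
    rw [Real.norm_of_nonneg hpos.le] at hCx
    exact hCx.trans (mul_le_mul_of_nonneg_right (le_max_right _ _) hpos.le)

/-- `w = (1 + G Q)⁻¹ w⁰` on `]a,∞[`, where `G` is the backward Green's operator. -/
def SolvesIntegralEq (Q : ℝ → ℂ) (m k : ℂ) (a : ℝ) (w : ℝ → ℂ) : Prop :=
  MemWeighted a (expWeight k) w ∧
    ∀ x, a < x → w x = freeJost m k x + greenIntegral m k (fun y => Q y * w y) x

namespace SolvesIntegralEq

lemma add_kernelOp_eq (h : SolvesIntegralEq Q m k a w) {x : ℝ} (hx : a < x) :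
    w x + kernelOp a (backwardGreenMul Q m k) w x = freeJost m k x := by
  rw [kernelOp_backwardGreenMul hx.le, h.2 x hx, add_neg_cancel_right]

lemma mono {b : ℝ} (hab : a ≤ b) (h : SolvesIntegralEq Q m k a w) : SolvesIntegralEq Q m k b w :=
  ⟨h.1.memLp.mono_measure (Measure.restrict_mono (Ioi_subset_Ioi hab) le_rfl),
    fun x hx => h.2 x (hab.trans_lt hx)⟩

lemma congr (h : SolvesIntegralEq Q m k a w) (hwv : EqOn w v (Ioi a)) :
    SolvesIntegralEq Q m k a v := by
  refine ⟨(memLp_congr_ae ?_).1 h.1.memLp, fun x hx => ?_⟩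
  · filter_upwards [ae_restrict_mem measurableSet_Ioi] with x hx
    rw [hwv hx]
  · rw [← hwv hx, h.2 x hx]
    congr 1
    refine setIntegral_congr_fun measurableSet_Ioi fun y hy => ?_
    simp only [hwv (hx.trans hy)]

lemma eqOn (hk : 0 ≤ k.re) (hk0 : k ≠ 0) (ha : 0 < a) (hQ : IntegrableOn Q (Ioi a))
    (hw : SolvesIntegralEq Q m k a w) (hv : SolvesIntegralEq Q m k a v) : EqOn w v (Ioi a) := by
  have hae := (oneAddInvertible_backwardGreenMul m hk hk0 ha hQ).injective w v hw.1 hv.1 (by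
    filter_upwards [ae_restrict_mem measurableSet_Ioi] with x hx
    rw [hw.add_kernelOp_eq hx, hv.add_kernelOp_eq hx])
  intro x hx
  have heq := hw.add_kernelOp_eq hx
  rw [← hv.add_kernelOp_eq hx, kernelOp_congr_ae hae] at heq
  exact add_right_cancel heq

end SolvesIntegralEq

lemma exists_solvesIntegralEq (m : ℂ) (hk : 0 ≤ k.re) (hk0 : k ≠ 0) (ha : 0 < a)
    (hQ : IntegrableOn Q (Ioi a)) : ∃ w, SolvesIntegralEq Q m k a w := by
  obtain ⟨w, hw, heq⟩ := (oneAddInvertible_backwardGreenMul m hk hk0 ha hQ).exists_add_kernelOp_eq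
    (memWeighted_freeJost m hk hk0 ha)
  refine ⟨w, hw, fun x hx => ?_⟩
  rw [← heq x hx, kernelOp_backwardGreenMul hx.le, neg_add_cancel_right]

theorem exists_forall_solvesIntegralEq (m : ℂ) (hk : 0 ≤ k.re) (hk0 : k ≠ 0)
    (hQ : ∀ a, 0 < a → IntegrableOn Q (Ioi a)) : ∃ w, ∀ a, 0 < a → SolvesIntegralEq Q m k a w := by
  choose! W hW using fun a (ha : 0 < a) => exists_solvesIntegralEq m hk hk0 ha (hQ a ha)
  refine ⟨fun x => W (x / 2) x, fun a ha => (hW a ha).congr fun x (hx : a < x) => ?_⟩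
  have hx0 : 0 < x / 2 := half_pos (ha.trans hx)
  have hb : max a (x / 2) < x := max_lt hx (half_lt_self (ha.trans hx))
  exact SolvesIntegralEq.eqOn hk hk0 (lt_max_of_lt_left ha) (hQ _ (lt_max_of_lt_left ha))
    ((hW a ha).mono (le_max_left _ _)) ((hW _ hx0).mono (le_max_right _ _)) hb

end IntegralEquation

section JostSolution

variable {Q f w : ℝ → ℂ} {m k : ℂ}

lemma IsSolution.solvesInhomogeneous (hf : IsSolution Q m k f) :
    SolvesInhomogeneous (besselCoeff m k) (fun x => Q x * f x) f (deriv f) where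
  hasDerivAt _ := hf.isAC1.hasDerivAt
  locallyAC := hf.isAC1.locallyAC_deriv
  ae_hasDerivAt := by simpa only [add_mul] using hf.ae_hasDerivAt_deriv

lemma SolvesInhomogeneous.isSolution {f' : ℝ → ℂ}
    (hf : SolvesInhomogeneous (besselCoeff m k) (fun x => Q x * f x) f f') :
    IsSolution Q m k f := by
  have hderiv : EqOn f' (deriv f) (Ioi 0) := fun x hx => (hf.hasDerivAt x hx).deriv.symm
  have hf := hf.congr (fun _ _ => rfl) hderiv
  refine isSolution_iff.2 ⟨⟨fun x hx =>
    (hf.hasDerivAt x hx).differentiableAt.differentiableWithinAt, hf.locallyAC⟩, ?_⟩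
  filter_upwards [hf.ae_hasDerivAt] with x hx
  rw [hx.deriv, add_mul]

theorem isJostSolution_of_solvesIntegralEq (hk : 0 ≤ k.re) (hk0 : k ≠ 0)
    (hQ : ∀ a, 0 < a → IntegrableOn Q (Ioi a)) (hw : ∀ a, 0 < a → SolvesIntegralEq Q m k a w) :
    IsJostSolution Q m k w := by
  have hg := fun a ha => (hw a ha).1.integrableOn_mul_div (hQ a ha)
  have heq : EqOn (fun x => freeJost m k x + greenIntegral m k (fun y => Q y * w y) x) w (Ioi 0) :=
    fun x hx => ((hw (x / 2) (half_pos hx)).2 x (half_lt_self hx)).symm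
  have hsol := ((solvesInhomogeneous_greenIntegral m hk hk0 hg).add_isClassical
    (continuousOn_besselCoeff m k) (isClassical_freeJost m hk hk0)).congr heq fun _ _ => rfl
  obtain ⟨hgreen, hgreen'⟩ := greenIntegral_isLittleO m hk hk0 one_pos (hg 1 one_pos)
  refine ⟨hsol.isSolution, hgreen.congr' ?_ .rfl, hgreen'.congr' ?_ .rfl⟩
  all_goals filter_upwards [eventually_gt_atTop 0] with x hx
  · rw [← heq hx, add_sub_cancel_left]
  · rw [(hsol.hasDerivAt x hx).deriv, add_sub_cancel_left]

lemma IsClassical.isBigO_inv_expWeight {h : ℝ → ℂ} (hh : IsClassical (besselCoeff m k) h)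
    (hk : 0 ≤ k.re) (hk0 : k ≠ 0) :
    h =O[atTop] (fun x => (expWeight k x)⁻¹) ∧ deriv h =O[atTop] fun x => (expWeight k x)⁻¹ := by
  obtain ⟨C, hC⟩ := hh.exists_norm_mul_expWeight_le hk hk0 one_pos
  have hO : ∀ u : ℝ → ℂ, (∀ x, 1 ≤ x → ‖u x‖ * expWeight k x ≤ C) →
      u =O[atTop] fun x => (expWeight k x)⁻¹ := fun u hu => by
    refine .of_bound C ?_
    filter_upwards [eventually_ge_atTop 1] with x hx
    have hpos := expWeight_pos k x
    rw [Real.norm_of_nonneg (inv_nonneg.2 hpos.le), ← div_eq_mul_inv, le_div_iff₀ hpos]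
    exact hu x hx
  exact ⟨hO h fun x hx => (hC x hx).1, hO (deriv h) fun x hx => (hC x hx).2⟩

lemma IsClassical.wronskian_eq_zero_of_isLittleO {v h : ℝ → ℂ}
    (hv : IsClassical (besselCoeff m k) v) (hh : IsClassical (besselCoeff m k) h) (hk : 0 ≤ k.re)
    (hk0 : k ≠ 0) (ho : v =o[atTop] expWeight k) (ho' : deriv v =o[atTop] expWeight k) {x : ℝ}
    (hx : 0 < x) : wronskian v h x = 0 := by
  obtain ⟨hO, hO'⟩ := hh.isBigO_inv_expWeight hk hk0
  have hlim := (ho.mul_isBigO hO').sub (ho'.mul_isBigO hO)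
  simp only [mul_inv_cancel₀ (expWeight_pos k _).ne'] at hlim
  refine tendsto_nhds_unique (tendsto_const_nhds.congr' ?_) ((isLittleO_one_iff ℝ).1 hlim)
  filter_upwards [eventually_gt_atTop 0] with y hy using hv.wronskian_eq hh hx hy

lemma IsClassical.eq_zero_of_isLittleO {v : ℝ → ℂ} (hv : IsClassical (besselCoeff m k) v)
    (hk : 0 ≤ k.re) (hk0 : k ≠ 0) (ho : v =o[atTop] expWeight k)
    (ho' : deriv v =o[atTop] expWeight k) {x : ℝ} (hx : 0 < x) : v x = 0 := by
  have h₁ := hv.wronskian_eq_zero_of_isLittleO (isClassical_fundamentalPair_fst m k)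
    hk hk0 ho ho' hx
  have h₂ := hv.wronskian_eq_zero_of_isLittleO (isClassical_fundamentalPair_snd m k)
    hk hk0 ho ho' hx
  have hW := wronskian_fundamentalPair_ne_zero m k
  rw [← wronskian_fundamentalPair m k hx] at hW
  refine (mul_eq_zero.1 ?_).resolve_right hW
  rw [wronskian] at h₁ h₂ ⊢
  linear_combination (fundamentalPair m k).1 x * h₂ - (fundamentalPair m k).2 x * h₁

lemma IsJostSolution.isBigO (hw : IsJostSolution Q m k w) (hk : 0 ≤ k.re) (hk0 : k ≠ 0) :
    w =O[atTop] expWeight k := by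
  obtain ⟨C, hC⟩ := exists_norm_freeJost_le m hk hk0 one_pos
  have hfree : freeJost m k =O[atTop] expWeight k := by
    refine .of_bound C ?_
    filter_upwards [eventually_gt_atTop 1] with x hx
    rw [Real.norm_of_nonneg (expWeight_pos k x).le]
    exact hC x hx
  simpa only [sub_add_cancel] using hw.sub_isLittleO.isBigO.add hfree

theorem IsJostSolution.solvesIntegralEq (hw : IsJostSolution Q m k w) (hk : 0 ≤ k.re)
    (hk0 : k ≠ 0) (hQ : ∀ a, 0 < a → IntegrableOn Q (Ioi a)) {a : ℝ} (ha : 0 < a) :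
    SolvesIntegralEq Q m k a w := by
  have hmem : ∀ a, 0 < a → MemWeighted a (expWeight k) w := fun a =>
    memWeighted_of_isBigO hw.isSolution.isAC1.continuousOn (hw.isBigO hk hk0)
  have hg := fun a ha => (hmem a ha).integrableOn_mul_div (hQ a ha)
  have hV := continuousOn_besselCoeff m k
  have hsol := (solvesInhomogeneous_greenIntegral m hk hk0 hg).add_isClassical hV
    (isClassical_freeJost m hk hk0)
  have hsub := hw.isSolution.solvesInhomogeneous.isClassical_sub hsol hV
  obtain ⟨hgreen, hgreen'⟩ := greenIntegral_isLittleO m hk hk0 one_pos (hg 1 one_pos)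
  have ho := (hw.sub_isLittleO.sub hgreen).congr_left fun x => sub_sub _ _ _
  have ho' := hw.deriv_sub_isLittleO.sub hgreen'
  refine ⟨hmem a ha, fun x hx => sub_eq_zero.1
    (hsub.eq_zero_of_isLittleO hk hk0 ho (ho'.congr' ?_ .rfl) (ha.trans hx))⟩
  filter_upwards [eventually_gt_atTop 0] with y hy
  rw [sub_sub]
  exact ((hw.isSolution.isAC1.hasDerivAt hy).fun_sub (hsol.hasDerivAt y hy)).deriv.symm

lemma isJostSolution_neg (hw : IsJostSolution Q (-m) k w) : IsJostSolution Q m k w := by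
  obtain ⟨⟨hAC, heq⟩, ho, ho'⟩ := hw
  rw [freeJost_neg] at ho ho'
  exact ⟨⟨hAC, by simpa only [besselOp, neg_sq] using heq⟩, ho, ho'⟩

theorem IsJostSolution.eqOn (hf : IsJostSolution Q m k f) (hw : IsJostSolution Q m k w)
    (hk : 0 ≤ k.re) (hk0 : k ≠ 0) (hQ : ∀ a, 0 < a → IntegrableOn Q (Ioi a)) :
    EqOn f w (Ioi 0) := by
  intro x (hx : 0 < x)
  have ha := half_pos hx
  exact SolvesIntegralEq.eqOn hk hk0 ha (hQ _ ha) (hf.solvesIntegralEq hk hk0 hQ ha)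
    (hw.solvesIntegralEq hk hk0 hQ ha) (half_lt_self hx)

end JostSolution

end PerturbedBessel

end

theorem mainTheorem4 (Q : ℝ → ℂ)
    (hloc : LocallyIntegrableOn Q (Ioi (0 : ℝ)) volume)
    (hQ : IntegrableOn Q (Ioi (1 : ℝ)) volume)
    (k : ℂ) (hk : 0 ≤ k.re) (hk0 : k ≠ 0) :
    ∃ w : ℂ → ℝ → ℂ,
      (∀ m : ℂ,
        PerturbedBessel.IsJostSolution Q m k (w m) ∧
        (∀ g : ℝ → ℂ, PerturbedBessel.IsJostSolution Q m k g → EqOn g (w m) (Ioi 0)) ∧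
        (∀ a : ℝ, 0 < a →
          PerturbedBessel.IsInverseImage a (PerturbedBessel.expWeight k)
            (PerturbedBessel.backwardGreenMul Q m k)
            (PerturbedBessel.freeJost m k) (w m))) ∧
      ∀ m : ℂ, EqOn (w m) (w (-m)) (Ioi 0) := by
  have hQa : ∀ a, 0 < a → IntegrableOn Q (Ioi a) := fun _ =>
    PerturbedBessel.integrableOn_Ioi_of_pos hloc hQ
  choose w hw using fun m => PerturbedBessel.exists_forall_solvesIntegralEq m hk hk0 hQa
  have hJost := fun m => PerturbedBessel.isJostSolution_of_solvesIntegralEq hk hk0 hQa (hw m)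
  refine ⟨w, fun m => ⟨hJost m, fun g hg => hg.eqOn (hJost m) hk hk0 hQa, fun a ha => ?_⟩,
    fun m => (hJost m).eqOn (PerturbedBessel.isJostSolution_neg (hJost (-m))) hk hk0 hQa⟩
  exact ⟨PerturbedBessel.oneAddInvertible_backwardGreenMul m hk hk0 ha (hQa a ha),
    PerturbedBessel.memWeighted_freeJost m hk hk0 ha, (hw m a ha).1,
    fun x hx => (hw m a ha).add_kernelOp_eq hx⟩
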